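/- Let $f : M \to N$ be a continuous map of topological spaces and let $\mathscr S$ be a sheaf of abelian groups on $M$. Let $N' \subset N$ be an open subset, put $M' = f^{-1}(N')$, and write $f' = f|_{M'} : M' \to N'$ and $\mathscr S' = \mathscr S|_{M'}$. Sheaf cohomology is computed by the canonical resolution $\mathscr T \to \mathscr A^0(\mathscr T) \to \mathscr A^1(\mathscr T) \to \cdots$ by discontinuous sections, where $\mathscr A^0(\mathscr T)$ is the sheaf $U \mapsto \prod_{x \in U} \mathscr T_x$, $\mathscr B^0(\mathscr T) = \mathscr T$, $\mathscr B^{p+1}(\mathscr T) = \mathscr A^0(\mathscr B^p(\mathscr T))/\mathscr B^p(\mathscr T)$ and $\mathscr A^p(\mathscr T) = \mathscr A^0(\mathscr B^p(\mathscr T))$; and $R^q f_*\mathscr S$ is the $q$-th cohomology sheaf of the complex $f_*\mathscr A^\bullet(\mathscr S)$. The Leray spectral sequence $$E_2^{p,q} = H^p(N, R^q f_*\mathscr S) \Longrightarrow H^{p+q}(M, \mathscr S)$$ is the spectral sequence of the filtration by $p$ of the double complex $A^{p,q} = \Gamma\big(N, \mathscr A^p(f_*\mathscr A^q(\mathscr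 S))\big)$ with total differential $(-1)^{p+q}\partial + \overline\partial$ on $A^{p,q}$, where $\partial$ comes from the canonical resolution on $N$ and $\overline\partial$ from that on $M$; the second terms and the limit are identified with the stated groups through the canonical maps, which are isomorphisms. Let $E_2'^{p,q} = H^p(N', R^q f'_*\mathscr S') \Rightarrow H^{p+q}(M', \mathscr S')$ be the Leray spectral sequence of $f'$ and $\mathscr S'$. For every $q \ge 0$ the canonical map $(R^q f_*\mathscr S)|_{N'} \to R^q f'_*\mathscr S'$ is an isomorphism. The five-term sequences of the two spectral sequences, made of the edge maps and the differentials $d_2$, $d_2'$, are exact, and they form a commutative diagram $$\begin{array}{ccccccccccc} 0 & \to & E_2^{1,0} & \to & H^1(M,\mathscr S) & \to & E_2^{0,1} & \xrightarrow{\,d_2\,} & E_2^{2,0} & \to & H^2(M,\mathscr S)\\ & & \downarrow & & \downarrow & & \downarrow & & \downarrow & & \downarrow\\ 0 & \to & E_2'^{1,0} & \to & H^1(M',\mathscr S') & \to & E_2'^{0,1} & \xrightarrow{\,d_2'\,} & E_2'^{2,0} & \to & H^2(M',\mathscr S'), \end{array}$$ in which the vertical maps $H^n(M,\mathscr S) \to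 H^n(M',\mathscr S')$ are the restriction maps from $M$ to $M'$, and the vertical maps $E_2^{p,q} \to E_2'^{p,q}$ are the restriction maps $H^p(N, R^q f_*\mathscr S) \to H^p(N', (R^q f_*\mathscr S)|_{N'})$ followed by the isomorphism induced by $(R^q f_*\mathscr S)|_{N'} \simeq R^q f'_*\mathscr S'$. -/

import Mathlib

open CategoryTheory CategoryTheory.Limits TopologicalSpace Opposite TopCat Topology

universe u

noncomputable section

namespace LerayFive

/-- Sheaves of abelian groups on the topological space `X`. -/
abbrev AbSheaf (X : TopCat.{u}) := TopCat.Sheaf AddCommGrpCat.{u} X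

lemma abSheaf_hom_ext {X : TopCat.{u}} {T T' : AbSheaf X} {φ ψ : T ⟶ T'}
    (h : ∀ (U : (Opens X)ᵒᵖ) (s : T.obj.obj U), φ.hom.app U s = ψ.hom.app U s) : φ = ψ := by
  apply ObjectProperty.hom_ext
  ext U s
  exact h U s

/-- The presheaf `U ↦ ∏_{x ∈ U} T_x` of discontinuous sections of `T`. -/
def discPresheaf {X : TopCat.{u}} (T : AbSheaf X) : TopCat.Presheaf AddCommGrpCat.{u} X where
  obj U := AddCommGrpCat.of (∀ x : U.unop, T.presheaf.stalk x.1)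
  map i := AddCommGrpCat.ofHom
    { toFun := fun s x => s (i.unop x)
      map_zero' := rfl
      map_add' := fun _ _ => rfl }

lemma discPresheaf_isSheaf {X : TopCat.{u}} (T : AbSheaf X) : (discPresheaf T).IsSheaf := by
  rw [TopCat.Presheaf.isSheaf_iff_isSheaf_comp (forget AddCommGrpCat.{u})]
  exact TopCat.Presheaf.toTypes_isSheaf X (fun x => T.presheaf.stalk x)

/-- The stalk functor at `x`, on sheaves of abelian groups. -/
abbrev stalkAt (X : TopCat.{u}) (x : X) : AbSheaf X ⥤ AddCommGrpCat.{u} :=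
  TopCat.Sheaf.forget AddCommGrpCat.{u} X ⋙ TopCat.Presheaf.stalkFunctor AddCommGrpCat.{u} x

/-- The functor `𝒜⁰`: the sheaf of discontinuous sections of a sheaf. -/
def disc (X : TopCat.{u}) : AbSheaf X ⥤ AbSheaf X where
  obj T := ⟨discPresheaf T, discPresheaf_isSheaf T⟩
  map {T T'} φ := ⟨{
    app := fun U => AddCommGrpCat.ofHom
      { toFun := fun s x => (stalkAt X x.1).map φ (s x)
        map_zero' := funext fun x => map_zero ((stalkAt X x.1).map φ).hom
        map_add' := fun s t => funext fun x => map_add ((stalkAt X x.1).map φ).hom (s x) (t x) }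
    naturality := fun _ _ _ => rfl }⟩
  map_id T := by
    refine abSheaf_hom_ext fun U s => funext fun x => ?_
    exact DFunLike.congr_fun (congrArg AddCommGrpCat.Hom.hom ((stalkAt X x.1).map_id T)) (s x)
  map_comp φ ψ := by
    refine abSheaf_hom_ext fun U s => funext fun x => ?_
    exact DFunLike.congr_fun (congrArg AddCommGrpCat.Hom.hom ((stalkAt X x.1).map_comp φ ψ)) (s x)

instance (X : TopCat.{u}) : (disc X).Additive where
  map_add {T T' φ ψ} := by
    refine abSheaf_hom_ext fun U s => funext fun x => ?_
    exact DFunLike.congr_fun (congrArg AddCommGrpCat.Hom.hom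
      ((stalkAt X x.1).map_add (f := φ) (g := ψ))) (s x)

/-- The canonical monomorphism `T → 𝒜⁰(T)`, which sends a section to the family of its germs. -/
def discUnit {X : TopCat.{u}} (T : AbSheaf X) : T ⟶ (disc X).obj T :=
  ⟨{app := fun U => AddCommGrpCat.ofHom
      { toFun := fun s x => T.presheaf.germ U.unop x.1 x.2 s
        map_zero' := funext fun x => map_zero (T.presheaf.germ U.unop x.1 x.2).hom
        map_add' := fun s t => funext fun x => map_add (T.presheaf.germ U.unop x.1 x.2).hom s t }
    naturality := fun U V i => by
      ext s
      funext x
      exact T.presheaf.germ_res_apply i.unop x.1 x.2 s }⟩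

lemma discUnit_naturality {X : TopCat.{u}} {T T' : AbSheaf X} (φ : T ⟶ T') :
    φ ≫ discUnit T' = discUnit T ≫ (disc X).map φ := by
  refine abSheaf_hom_ext fun U s => funext fun x => ?_
  exact (TopCat.Presheaf.stalkFunctor_map_germ_apply U.unop x.1 x.2 φ.hom s).symm

/-- The functor `ℬ¹`: the quotient sheaf `ℬ¹(T) = 𝒜⁰(T) / T`. -/
def quot (X : TopCat.{u}) : AbSheaf X ⥤ AbSheaf X where
  obj T := cokernel (discUnit T)
  map φ := cokernel.map _ _ φ ((disc X).map φ) (discUnit_naturality φ).symm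

/-- The projection `𝒜⁰(T) → ℬ¹(T)`. -/
def quotπ {X : TopCat.{u}} (T : AbSheaf X) : (disc X).obj T ⟶ (quot X).obj T :=
  cokernel.π (discUnit T)

lemma quotπ_naturality {X : TopCat.{u}} {T T' : AbSheaf X} (φ : T ⟶ T') :
    (disc X).map φ ≫ quotπ T' = quotπ T ≫ (quot X).map φ := by
  simp [quot, quotπ]

lemma discUnit_quotπ {X : TopCat.{u}} (T : AbSheaf X) : discUnit T ≫ quotπ T = 0 :=
  cokernel.condition _

instance {X : TopCat.{u}} (T : AbSheaf X) : Epi (quotπ T) :=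
  inferInstanceAs (Epi (cokernel.π _))

instance (X : TopCat.{u}) : (quot X).Additive where
  map_add {T T' φ ψ} := by
    rw [← cancel_epi (quotπ T), Preadditive.comp_add, ← quotπ_naturality, ← quotπ_naturality,
      ← quotπ_naturality, Functor.map_add, Preadditive.add_comp]

/-- The functors `ℬ^p`, with `ℬ⁰(T) = T` and `ℬ^{p+1}(T) = 𝒜⁰(ℬ^p(T)) / ℬ^p(T)`. -/
def syz (X : TopCat.{u}) : ℕ → (AbSheaf X ⥤ AbSheaf X)
  | 0 => 𝟭 _
  | p + 1 => syz X p ⋙ quot X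

instance syz_additive (X : TopCat.{u}) : ∀ p, (syz X p).Additive
  | 0 => inferInstanceAs (𝟭 (AbSheaf X)).Additive
  | p + 1 => by
    have := syz_additive X p
    exact inferInstanceAs (syz X p ⋙ quot X).Additive

/-- The functors `𝒜^p`, with `𝒜^p(T) = 𝒜⁰(ℬ^p(T))`. -/
abbrev can (X : TopCat.{u}) (p : ℕ) : AbSheaf X ⥤ AbSheaf X := syz X p ⋙ disc X

/-- The composite `𝒜⁰(T) → ℬ¹(T) → 𝒜⁰(ℬ¹(T))`. -/
def discD {X : TopCat.{u}} (T : AbSheaf X) : (disc X).obj T ⟶ (disc X).obj ((quot X).obj T) :=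
  quotπ T ≫ discUnit ((quot X).obj T)

lemma discD_naturality {X : TopCat.{u}} {T T' : AbSheaf X} (φ : T ⟶ T') :
    (disc X).map φ ≫ discD T' = discD T ≫ (disc X).map ((quot X).map φ) := by
  rw [discD, discD, Category.assoc, ← discUnit_naturality, ← Category.assoc, quotπ_naturality,
    Category.assoc]

lemma discD_discD {X : TopCat.{u}} (T : AbSheaf X) : discD T ≫ discD ((quot X).obj T) = 0 := by
  rw [discD, discD, Category.assoc, ← Category.assoc (discUnit _), discUnit_quotπ, zero_comp,
    comp_zero]

/-- The differential `∂ : 𝒜^p(T) → 𝒜^{p+1}(T)` of the canonical resolution. -/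
def canD {X : TopCat.{u}} (T : AbSheaf X) (p : ℕ) : (can X p).obj T ⟶ (can X (p + 1)).obj T :=
  discD ((syz X p).obj T)

lemma canD_naturality {X : TopCat.{u}} {T T' : AbSheaf X} (φ : T ⟶ T') (p : ℕ) :
    (can X p).map φ ≫ canD T' p = canD T p ≫ (can X (p + 1)).map φ :=
  discD_naturality ((syz X p).map φ)

lemma canD_canD {X : TopCat.{u}} (T : AbSheaf X) (p : ℕ) : canD T p ≫ canD T (p + 1) = 0 :=
  discD_discD ((syz X p).obj T)

/-- The canonical resolution `𝒜⁰(T) → 𝒜¹(T) → 𝒜²(T) → ⋯` of `T`. -/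
def canResObj {X : TopCat.{u}} (T : AbSheaf X) : CochainComplex (AbSheaf X) ℕ :=
  CochainComplex.of (fun p => (can X p).obj T) (canD T) (canD_canD T)

lemma canResObj_d {X : TopCat.{u}} (T : AbSheaf X) (p : ℕ) :
    (canResObj T).d p (p + 1) = canD T p :=
  CochainComplex.of_d (fun p => (can X p).obj T) (canD T) p

/-- The canonical resolution, as a functor of the sheaf. -/
def canRes (X : TopCat.{u}) : AbSheaf X ⥤ CochainComplex (AbSheaf X) ℕ where
  obj T := canResObj T
  map {T T'} φ := CochainComplex.ofHom (fun p => (can X p).map φ) (fun p => by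
    rw [canResObj_d, canResObj_d]
    exact canD_naturality φ p)
  map_id T := by ext p : 1; exact (can X p).map_id T
  map_comp φ ψ := by ext p : 1; exact (can X p).map_comp φ ψ

instance (X : TopCat.{u}) : (canRes X).Additive where
  map_add {T T' φ ψ} := by
    ext p : 1
    exact Functor.map_add (can X p)

/-- Global sections `Γ(X, -)`. -/
def glob (X : TopCat.{u}) : AbSheaf X ⥤ AddCommGrpCat.{u} :=
  TopCat.Sheaf.forget AddCommGrpCat.{u} X ⋙ (evaluation _ _).obj (op ⊤)

instance (X : TopCat.{u}) : (glob X).Additive where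

/-- The complex `Γ(X, 𝒜^•(T))` of global sections of the canonical resolution. -/
def canSec (X : TopCat.{u}) : AbSheaf X ⥤ CochainComplex AddCommGrpCat.{u} ℕ :=
  canRes X ⋙ (glob X).mapHomologicalComplex _

instance (X : TopCat.{u}) : (canSec X).Additive :=
  inferInstanceAs (canRes X ⋙ (glob X).mapHomologicalComplex _).Additive

/-- Sheaf cohomology `H^n(X, T)`, the cohomology of `Γ(X, 𝒜^•(T))`. -/
def coh (X : TopCat.{u}) (n : ℕ) : AbSheaf X ⥤ AddCommGrpCat.{u} :=
  canSec X ⋙ HomologicalComplex.homologyFunctor _ _ n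

/-- The germ at `x` of a section over `U ∋ x`. -/
def germAt {X : TopCat.{u}} (T : AbSheaf X) (U : Opens X) (x : X) (hx : x ∈ U) :
    T.obj.obj (op U) ⟶ (stalkAt X x).obj T :=
  TopCat.Presheaf.germ T.obj U x hx

lemma exists_germAt {X : TopCat.{u}} (T : AbSheaf X) (x : X) (t : (stalkAt X x).obj T) :
    ∃ (U : Opens X) (hx : x ∈ U) (s : T.obj.obj (op U)), germAt T U x hx s = t :=
  TopCat.Presheaf.exists_germ_eq T.obj t

lemma map_germAt {X : TopCat.{u}} {T T' : AbSheaf X} (φ : T ⟶ T') (U : Opens X) (x : X)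
    (hx : x ∈ U) (s : T.obj.obj (op U)) :
    (stalkAt X x).map φ (germAt T U x hx s) = germAt T' U x hx (φ.hom.app (op U) s) :=
  TopCat.Presheaf.stalkFunctor_map_germ_apply U x hx φ.hom s

lemma germAt_eq_zero {X : TopCat.{u}} (T : AbSheaf X) (U : Opens X) (x : X) (hx : x ∈ U)
    (s : T.obj.obj (op U)) (hs : germAt T U x hx s = 0) :
    ∃ (V : Opens X) (_ : x ∈ V) (i : V ⟶ U), T.obj.map i.op s = 0 := by
  obtain ⟨V, hV, i, j, h⟩ := TopCat.Presheaf.germ_eq T.obj x hx hx s 0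
    (hs.trans (map_zero (germAt T U x hx).hom).symm)
  exact ⟨V, hV, i, h.trans (map_zero (T.obj.map j.op).hom)⟩

lemma exact_stalks {X : TopCat.{u}} (S : ShortComplex (AbSheaf X)) :
    S.Exact ↔ ∀ (x : X) (b : (stalkAt X x).obj S.X₂), (stalkAt X x).map S.g b = 0 →
      ∃ a, (stalkAt X x).map S.f a = b := by
  rw [TopCat.Sheaf.exact_iff_stalkFunctor_map_exact]
  exact forall_congr' fun x => ShortComplex.ab_exact_iff _

lemma disc_sections_exact {X : TopCat.{u}} {S : ShortComplex (AbSheaf X)} (hS : S.Exact)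
    (U : (Opens X)ᵒᵖ) (b : ((disc X).obj S.X₂).obj.obj U)
    (hb : ((disc X).map S.g).hom.app U b = 0) :
    ∃ a, ((disc X).map S.f).hom.app U a = b := by
  have h : ∀ x : U.unop, ∃ a, (stalkAt X x.1).map S.f a = b x := fun x =>
    (exact_stalks S).1 hS x.1 (b x) (congrFun hb x)
  choose a ha using h
  exact ⟨a, funext ha⟩

instance discGlob_preservesHomology (X : TopCat.{u}) : (disc X ⋙ glob X).PreservesHomology := by
  refine ((disc X ⋙ glob X).exact_tfae.out 1 2).1 fun S hS => ?_
  rw [ShortComplex.ab_exact_iff]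
  exact disc_sections_exact hS (op ⊤)

lemma disc_stalks_exact {X : TopCat.{u}} {S : ShortComplex (AbSheaf X)} (hS : S.Exact) (x : X)
    (b : (stalkAt X x).obj ((disc X).obj S.X₂))
    (hb : (stalkAt X x).map ((disc X).map S.g) b = 0) :
    ∃ a, (stalkAt X x).map ((disc X).map S.f) a = b := by
  obtain ⟨U, hx, s, rfl⟩ := exists_germAt _ _ b
  rw [map_germAt] at hb
  obtain ⟨V, hV, i, h⟩ := germAt_eq_zero _ _ _ _ _ hb
  have h' : ((disc X).map S.g).hom.app (op V) (((disc X).obj S.X₂).obj.map i.op s) = 0 := h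
  obtain ⟨a, ha⟩ := disc_sections_exact hS (op V) _ h'
  refine ⟨germAt _ V x hV a, ?_⟩
  rw [map_germAt, ha]
  exact TopCat.Presheaf.germ_res_apply _ i x hV s

/-- The map `𝒜⁰(T)_x → T_x` which evaluates a discontinuous section at `x`. -/
def discEval {X : TopCat.{u}} (T : AbSheaf X) (x : X) :
    (stalkAt X x).obj ((disc X).obj T) ⟶ (stalkAt X x).obj T :=
  colimit.desc ((OpenNhds.inclusion x).op ⋙ discPresheaf T)
    { pt := (stalkAt X x).obj T
      ι :=
        { app := fun V => AddCommGrpCat.ofHom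
            { toFun := fun s : (∀ y : V.unop.1, T.presheaf.stalk y.1) => s ⟨x, V.unop.2⟩
              map_zero' := rfl
              map_add' := fun _ _ => rfl }
          naturality := fun _ _ _ => rfl } }

lemma discEval_germ {X : TopCat.{u}} (T : AbSheaf X) (x : X) (U : Opens X) (hx : x ∈ U)
    (s : ((disc X).obj T).obj.obj (op U)) :
    discEval T x (germAt _ U x hx s) = s ⟨x, hx⟩ := by
  have : germAt ((disc X).obj T) U x hx ≫ discEval T x = _ :=
    colimit.ι_desc (F := (OpenNhds.inclusion x).op ⋙ discPresheaf T) _ (op (⟨U, hx⟩ : OpenNhds x))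
  exact DFunLike.congr_fun (congrArg AddCommGrpCat.Hom.hom this) s

lemma discEval_unit {X : TopCat.{u}} (T : AbSheaf X) (x : X) (t : (stalkAt X x).obj T) :
    discEval T x ((stalkAt X x).map (discUnit T) t) = t := by
  obtain ⟨U, hx, s, rfl⟩ := exists_germAt _ _ t
  rw [map_germAt, discEval_germ]
  rfl

lemma discEval_naturality {X : TopCat.{u}} {T T' : AbSheaf X} (φ : T ⟶ T') (x : X)
    (t : (stalkAt X x).obj ((disc X).obj T)) :
    discEval T' x ((stalkAt X x).map ((disc X).map φ) t) = (stalkAt X x).map φ (discEval T x t) := by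
  obtain ⟨U, hx, s, rfl⟩ := exists_germAt _ _ t
  rw [map_germAt, discEval_germ, discEval_germ]
  rfl

lemma stalkAt_comp_apply {X : TopCat.{u}} {T T' T'' : AbSheaf X} (φ : T ⟶ T') (ψ : T' ⟶ T'') (x : X)
    (t : (stalkAt X x).obj T) :
    (stalkAt X x).map ψ ((stalkAt X x).map φ t) = (stalkAt X x).map (φ ≫ ψ) t := by
  rw [Functor.map_comp]; rfl

lemma quotπ_surj {X : TopCat.{u}} (T : AbSheaf X) (x : X) (b : (stalkAt X x).obj ((quot X).obj T)) :
    ∃ a, (stalkAt X x).map (quotπ T) a = b := by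
  have : Epi ((stalkAt X x).map (quotπ T)) := inferInstance
  exact (AddCommGrpCat.epi_iff_surjective _).1 this b

lemma quotπ_exact {X : TopCat.{u}} (T : AbSheaf X) (x : X) (b : (stalkAt X x).obj ((disc X).obj T))
    (hb : (stalkAt X x).map (quotπ T) b = 0) : ∃ a, (stalkAt X x).map (discUnit T) a = b :=
  (exact_stalks _).1 (ShortComplex.exact_cokernel (discUnit T)) x b hb

instance quot_preservesHomology (X : TopCat.{u}) : (quot X).PreservesHomology := by
  refine ((quot X).exact_tfae.out 1 2).1 fun S hS => ?_
  rw [exact_stalks]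
  intro x b hb
  obtain ⟨b, rfl⟩ := quotπ_surj _ _ b
  change (stalkAt X x).map ((quot X).map S.g) _ = 0 at hb
  rw [stalkAt_comp_apply, ← quotπ_naturality, ← stalkAt_comp_apply] at hb
  obtain ⟨c, hc⟩ := quotπ_exact _ _ _ hb
  have hc' : c = (stalkAt X x).map S.g (discEval _ x b) := by
    rw [← discEval_naturality, ← hc, discEval_unit]
  have hb' : (stalkAt X x).map ((disc X).map S.g)
      (b - (stalkAt X x).map (discUnit _) (discEval _ x b)) = 0 := by
    rw [map_sub, ← hc, stalkAt_comp_apply, ← discUnit_naturality, ← stalkAt_comp_apply, ← hc',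
      sub_self]
  obtain ⟨a, ha⟩ := disc_stalks_exact hS x _ hb'
  refine ⟨(stalkAt X x).map (quotπ _) a, ?_⟩
  change (stalkAt X x).map ((quot X).map S.f) _ = _
  rw [stalkAt_comp_apply, ← quotπ_naturality, ← stalkAt_comp_apply, ha, map_sub,
    stalkAt_comp_apply (discUnit _), discUnit_quotπ, Functor.map_zero]
  exact sub_zero _

lemma comp_preservesHomology {C D E : Type*} [Category* C] [Category* D] [Category* E]
    [Abelian C] [Abelian D] [Abelian E] (F : C ⥤ D) (G : D ⥤ E) [F.Additive] [G.Additive]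
    [F.PreservesHomology] [G.PreservesHomology] : (F ⋙ G).PreservesHomology :=
  ((F ⋙ G).exact_tfae.out 1 2).1 fun (S : ShortComplex C) (hS : S.Exact) => (hS.map F).map G

instance syz_preservesHomology (X : TopCat.{u}) : ∀ p, (syz X p).PreservesHomology
  | 0 => inferInstanceAs (𝟭 (AbSheaf X)).PreservesHomology
  | p + 1 => by
    have := syz_preservesHomology X p
    exact comp_preservesHomology (syz X p) (quot X)

/-- The functor `T ↦ Γ(X, 𝒜^p(T))`. -/
def secF (X : TopCat.{u}) (p : ℕ) : AbSheaf X ⥤ AddCommGrpCat.{u} :=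
  canSec X ⋙ HomologicalComplex.eval _ _ p

instance (X : TopCat.{u}) (p : ℕ) : (secF X p).Additive :=
  inferInstanceAs (canSec X ⋙ HomologicalComplex.eval _ _ p).Additive

instance (X : TopCat.{u}) (p : ℕ) : (secF X p).PreservesHomology :=
  comp_preservesHomology (syz X p) (disc X ⋙ glob X)

section Restriction

variable {X' X : TopCat.{u}} {j : X' ⟶ X} (hj : IsOpenEmbedding j)

/-- Restriction `T ↦ T|_{X'}` along an open embedding `j : X' → X`, that is
`T|_{X'}(V) = T(j(V))`. -/
abbrev res : AbSheaf X ⥤ AbSheaf X' := hj.sheafPullback AddCommGrpCat.{u}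

instance : (res hj).Additive where
  map_add := rfl

/-- The comparison of stalks `T_{j y} ≅ (T|_{X'})_y`. -/
def resStalk (T : AbSheaf X) (y : X') :
    (stalkAt X (j y)).obj T ≅ (stalkAt X' y).obj ((res hj).obj T) :=
  (AlgebraicGeometry.PresheafedSpace.restrictStalkIso
    (⟨X, T.obj⟩ : AlgebraicGeometry.PresheafedSpace AddCommGrpCat.{u}) hj y).symm

/-- The germ at `j y` of a section over `j(V)`, where `y ∈ V`. -/
def germRes (T : AbSheaf X) (V : Opens X') (y : X') (hy : y ∈ V) :
    ((res hj).obj T).obj.obj (op V) ⟶ (stalkAt X (j y)).obj T :=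
  germAt T (hj.functor.obj V) (j y) ⟨y, hy, rfl⟩

lemma resStalk_germ (T : AbSheaf X) (V : Opens X') (y : X') (hy : y ∈ V)
    (s : ((res hj).obj T).obj.obj (op V)) :
    (resStalk hj T y).hom (germRes hj T V y hy s) = germAt ((res hj).obj T) V y hy s :=
  DFunLike.congr_fun (congrArg AddCommGrpCat.Hom.hom
    (AlgebraicGeometry.PresheafedSpace.restrictStalkIso_inv_eq_germ
      (⟨X, T.obj⟩ : AlgebraicGeometry.PresheafedSpace AddCommGrpCat.{u}) hj V y hy)) s

lemma resStalk_inj (T : AbSheaf X) (y : X') : Function.Injective (resStalk hj T y).hom :=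
  (AddCommGrpCat.mono_iff_injective (resStalk hj T y).hom).1 inferInstance

lemma resStalk_surj (T : AbSheaf X) (y : X') : Function.Surjective (resStalk hj T y).hom :=
  (AddCommGrpCat.epi_iff_surjective (resStalk hj T y).hom).1 inferInstance

lemma exists_germRes (T : AbSheaf X) (y : X') (t : (stalkAt X (j y)).obj T) :
    ∃ (V : Opens X') (hy : y ∈ V) (s : ((res hj).obj T).obj.obj (op V)),
      germRes hj T V y hy s = t := by
  obtain ⟨V, hy, s, hs⟩ := exists_germAt _ _ ((resStalk hj T y).hom t)
  exact ⟨V, hy, s, resStalk_inj hj T y ((resStalk_germ hj T V y hy s).trans hs)⟩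

lemma map_germRes {T T' : AbSheaf X} (φ : T ⟶ T') (V : Opens X') (y : X') (hy : y ∈ V)
    (s : ((res hj).obj T).obj.obj (op V)) :
    (stalkAt X (j y)).map φ (germRes hj T V y hy s) =
      germRes hj T' V y hy (((res hj).map φ).hom.app (op V) s) :=
  map_germAt φ _ _ _ s

lemma resStalk_naturality {T T' : AbSheaf X} (φ : T ⟶ T') (y : X') (t : (stalkAt X (j y)).obj T) :
    (resStalk hj T' y).hom ((stalkAt X (j y)).map φ t) =
      (stalkAt X' y).map ((res hj).map φ) ((resStalk hj T y).hom t) := by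
  obtain ⟨V, hy, s, rfl⟩ := exists_germRes hj T y t
  rw [map_germRes, resStalk_germ, resStalk_germ, map_germAt]

instance : (res hj).PreservesHomology := by
  refine ((res hj).exact_tfae.out 1 2).1 fun S hS => ?_
  rw [exact_stalks]
  intro y b hb
  obtain ⟨b, rfl⟩ := resStalk_surj hj S.X₂ y b
  change (stalkAt X' y).map ((res hj).map S.g) _ = 0 at hb
  rw [← resStalk_naturality] at hb
  obtain ⟨a, rfl⟩ := (exact_stalks S).1 hS (j y) b
    (resStalk_inj hj S.X₃ y (hb.trans (map_zero (resStalk hj S.X₃ y).hom.hom).symm))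
  exact ⟨(resStalk hj S.X₁ y).hom a, (resStalk_naturality hj S.f y a).symm⟩

instance : PreservesFiniteColimits (res hj) :=
  Functor.preservesFiniteColimits_of_preservesHomology _

/-- The canonical map `𝒜⁰(T)|_{X'} → 𝒜⁰(T|_{X'})`, given by the identification of stalks. -/
def resDisc (T : AbSheaf X) :
    (res hj).obj ((disc X).obj T) ⟶ (disc X').obj ((res hj).obj T) :=
  ⟨{ app := fun V => AddCommGrpCat.ofHom
      { toFun := fun (s : ∀ x : hj.functor.obj V.unop, T.presheaf.stalk x.1) y =>
          (resStalk hj T y.1).hom (s ⟨j y.1, ⟨y.1, y.2, rfl⟩⟩)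
        map_zero' := funext fun y => map_zero (resStalk hj T y.1).hom.hom
        map_add' := fun _ _ => funext fun y => map_add (resStalk hj T y.1).hom.hom _ _ }
     naturality := fun _ _ _ => rfl }⟩

lemma resDisc_unit (T : AbSheaf X) :
    (res hj).map (discUnit T) ≫ resDisc hj T = discUnit ((res hj).obj T) :=
  abSheaf_hom_ext fun V s => funext fun y => resStalk_germ hj T V.unop y.1 y.2 s

/-- The map `ℬ¹(T)|_{X'} → ℬ¹(T|_{X'})` induced by `resDisc` on quotients. -/
def resQuot (T : AbSheaf X) :
    (res hj).obj ((quot X).obj T) ⟶ (quot X').obj ((res hj).obj T) :=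
  (PreservesCokernel.iso (res hj) (discUnit T)).hom ≫
    cokernel.map _ _ (𝟙 _) (resDisc hj T) ((resDisc_unit hj T).trans (Category.id_comp _).symm)

lemma resQuot_π (T : AbSheaf X) :
    (res hj).map (quotπ T) ≫ resQuot hj T = resDisc hj T ≫ quotπ ((res hj).obj T) := by
  have h := PreservesCokernel.π_iso_hom (res hj) (discUnit T)
  have h' : cokernel.π ((res hj).map (discUnit T)) ≫ cokernel.map ((res hj).map (discUnit T))
      (discUnit ((res hj).obj T)) (𝟙 _) (resDisc hj T)
        ((resDisc_unit hj T).trans (Category.id_comp _).symm) = resDisc hj T ≫ cokernel.π _ :=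
    cokernel.π_desc _ _ _
  refine Eq.trans ?_ h'
  rw [← h, Category.assoc]
  rfl

instance (T : AbSheaf X) : Epi ((res hj).map (quotπ T)) := inferInstance

/-- The canonical maps `ℬ^p(T)|_{X'} → ℬ^p(T|_{X'})`. -/
def resSyz (T : AbSheaf X) : ∀ p,
    (res hj).obj ((syz X p).obj T) ⟶ (syz X' p).obj ((res hj).obj T)
  | 0 => 𝟙 _
  | p + 1 => resQuot hj ((syz X p).obj T) ≫ (quot X').map (resSyz T p)

/-- The canonical maps `𝒜^p(T)|_{X'} → 𝒜^p(T|_{X'})`. -/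
def resCan (T : AbSheaf X) (p : ℕ) :
    (res hj).obj ((can X p).obj T) ⟶ (can X' p).obj ((res hj).obj T) :=
  resDisc hj ((syz X p).obj T) ≫ (disc X').map (resSyz hj T p)

lemma resCan_d (T : AbSheaf X) (p : ℕ) :
    resCan hj T p ≫ canD ((res hj).obj T) p = (res hj).map (canD T p) ≫ resCan hj T (p + 1) := by
  change (resDisc hj ((syz X p).obj T) ≫ (disc X').map (resSyz hj T p)) ≫
      quotπ ((syz X' p).obj ((res hj).obj T)) ≫ discUnit _ =
    (res hj).map (quotπ ((syz X p).obj T) ≫ discUnit _) ≫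
      resDisc hj ((quot X).obj ((syz X p).obj T)) ≫ (disc X').map (resQuot hj ((syz X p).obj T) ≫ (quot X').map (resSyz hj T p))
  rw [Functor.map_comp, Category.assoc, Category.assoc, ← Category.assoc ((res hj).map (discUnit _)),
    resDisc_unit, ← discUnit_naturality, ← Category.assoc ((res hj).map _), ← Category.assoc ((res hj).map _), resQuot_π,
    ← Category.assoc ((disc X').map _), quotπ_naturality]
  simp only [Category.assoc]

/-- The canonical map from the restriction to `X'` of the canonical resolution of `T` to the
canonical resolution of `T|_{X'}`. -/
def resCanRes (T : AbSheaf X) :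
    ((res hj).mapHomologicalComplex _).obj ((canRes X).obj T) ⟶ (canRes X').obj ((res hj).obj T) :=
  CochainComplex.ofHom (resCan hj T) (fun p => by
    change resCan hj T p ≫ (canResObj ((res hj).obj T)).d p (p + 1) =
      (res hj).map ((canResObj T).d p (p + 1)) ≫ resCan hj T (p + 1)
    rw [canResObj_d, canResObj_d]
    exact resCan_d hj T p)

end Restriction

/-- First quadrant double complexes of abelian groups with commuting differentials; the outer
index is `q` and the inner index is `p`. -/
abbrev DblCpx := HomologicalComplex₂ AddCommGrpCat.{u} (ComplexShape.up ℕ) (ComplexShape.up ℕ)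

namespace DblCpx

variable (K : DblCpx.{u})

/-- The group `A^{p,q}`. -/
abbrev A (p q : ℕ) : Type u := (K.X q).X p

/-- The first differential `∂ : A^{p,q} → A^{p+1,q}`, without sign. -/
def d₁ (p q : ℕ) : K.A p q →+ K.A (p + 1) q := ((K.X q).d p (p + 1)).hom

/-- The second differential `∂̄ : A^{p,q} → A^{p,q+1}`. -/
def d₂ (p q : ℕ) : K.A p q →+ K.A p (q + 1) := ((K.d q (q + 1)).f p).hom

lemma d₁_d₁ (p q : ℕ) (x : K.A p q) : d₁ K (p + 1) q (d₁ K p q x) = 0 :=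
  DFunLike.congr_fun (congrArg AddCommGrpCat.Hom.hom ((K.X q).d_comp_d p (p + 1) (p + 1 + 1))) x

lemma d₂_d₂ (p q : ℕ) (x : K.A p q) : d₂ K p (q + 1) (d₂ K p q x) = 0 :=
  DFunLike.congr_fun (congrArg AddCommGrpCat.Hom.hom
    (congrArg (fun φ => HomologicalComplex.Hom.f φ p) (K.d_comp_d q (q + 1) (q + 1 + 1)))) x

lemma d₁_d₂ (p q : ℕ) (x : K.A p q) : d₁ K p (q + 1) (d₂ K p q x) = d₂ K (p + 1) q (d₁ K p q x) :=
  DFunLike.congr_fun (congrArg AddCommGrpCat.Hom.hom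
    ((K.d q (q + 1)).comm p (p + 1))) x

/-- All families `(x^{p,q})` of elements of the `A^{p,q}`. The group `A^n = ⨁_{p+q=n} A^{p,q}` is
the subgroup `deg n` below. -/
abbrev Cochain : Type u := ∀ p q : ℕ, K.A p q

/-- The first part of the total differential, `(-1)^{p+q} ∂` on `A^{p,q}`. -/
def horiz : K.Cochain → K.Cochain := fun x p q =>
  match p with
  | 0 => 0
  | p' + 1 => (-1 : ℤ) ^ (p' + q) • d₁ K p' q (x p' q)

/-- The second part of the total differential, `∂̄` on `A^{p,q}`. -/
def vert : K.Cochain → K.Cochain := fun x p q =>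
  match q with
  | 0 => 0
  | q' + 1 => d₂ K p q' (x p q')

/-- The total differential `(-1)^{p+q} ∂ + ∂̄`. -/
def D : K.Cochain →+ K.Cochain where
  toFun x := horiz K x + vert K x
  map_zero' := by
    funext p q
    cases p <;> cases q <;> simp [horiz, vert]
  map_add' x y := by
    funext p q
    cases p <;> cases q <;> (simp [horiz, vert]; try abel)

lemma D_D (x : K.Cochain) : D K (D K x) = 0 := by
  funext p q
  rcases p with _ | _ | p <;> rcases q with _ | _ | q <;>
    simp [D, horiz, vert, d₁_d₁, d₂_d₂, d₁_d₂, pow_add, pow_succ]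

/-- The group `A^n` of the families that vanish outside `p + q = n`. -/
def deg (n : ℕ) : AddSubgroup K.Cochain where
  carrier := {x | ∀ p q, p + q ≠ n → x p q = 0}
  zero_mem' := fun _ _ _ => rfl
  add_mem' := fun {x y} hx hy p q h => by simp [hx p q h, hy p q h]
  neg_mem' := fun {x} hx p q h => by simp [hx p q h]

/-- The group `A^{n-1}`, which is `0` for `n = 0`. -/
def degPred (n : ℕ) : AddSubgroup K.Cochain where
  carrier := {x | ∀ p q, p + q + 1 ≠ n → x p q = 0}
  zero_mem' := fun _ _ _ => rfl
  add_mem' := fun {x y} hx hy p q h => by simp [hx p q h, hy p q h]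
  neg_mem' := fun {x} hx p q h => by simp [hx p q h]

/-- The first filtration: the families that vanish for `p < i`. -/
def fil (i : ℕ) : AddSubgroup K.Cochain where
  carrier := {x | ∀ p q, p < i → x p q = 0}
  zero_mem' := fun _ _ _ => rfl
  add_mem' := fun {x y} hx hy p q h => by simp [hx p q h, hy p q h]
  neg_mem' := fun {x} hx p q h => by simp [hx p q h]

lemma D_deg (n : ℕ) (x : K.Cochain) (hx : x ∈ deg K n) : D K x ∈ deg K (n + 1) := by
  intro p q h
  rcases p with _ | p <;> rcases q with _ | q
  · simp [D, horiz, vert]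
  · simp [D, horiz, vert, hx 0 q (by omega)]
  · simp [D, horiz, vert, hx p 0 (by omega)]
  · simp [D, horiz, vert, hx p (q + 1) (by omega), hx (p + 1) q (by omega)]

lemma D_degPred (n : ℕ) (x : K.Cochain) (hx : x ∈ degPred K n) : D K x ∈ deg K n := by
  intro p q h
  rcases p with _ | p <;> rcases q with _ | q
  · simp [D, horiz, vert]
  · simp [D, horiz, vert, hx 0 q (by omega)]
  · simp [D, horiz, vert, hx p 0 (by omega)]
  · simp [D, horiz, vert, hx p (q + 1) (by omega), hx (p + 1) q (by omega)]

lemma D_fil (i : ℕ) (x : K.Cochain) (hx : x ∈ fil K i) : D K x ∈ fil K i := by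
  intro p q h
  rcases p with _ | p <;> rcases q with _ | q
  · simp [D, horiz, vert]
  · simp [D, horiz, vert, hx 0 q (by omega)]
  · simp [D, horiz, vert, hx p 0 (by omega)]
  · simp [D, horiz, vert, hx p (q + 1) (by omega), hx (p + 1) q (by omega)]

/-- `Z_r^{p,q} = {x ∈ F^p A^n | D x ∈ F^{p+r}}`, where `n = p + q`. -/
def Z (r p n : ℕ) : AddSubgroup K.Cochain := deg K n ⊓ fil K p ⊓ (fil K (p + r)).comap (D K)

/-- `Z_{r-1}^{p+1,q-1} + D Z_{r-1}^{p-r+1,q+r-2}`, where `n = p + q`. -/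
def B (r p n : ℕ) : AddSubgroup K.Cochain :=
  Z K (r - 1) (p + 1) n ⊔ ((degPred K n ⊓ fil K (p + 1 - r)).map (D K) ⊓ fil K p)

/-- The term `E_r^{p,q} = Z_r^{p,q} / (Z_{r-1}^{p+1,q-1} + D Z_{r-1}^{p-r+1,q+r-2})` of the spectral
sequence of the first filtration, where `n = p + q`. -/
abbrev E (r p n : ℕ) : Type u := Z K r p n ⧸ (B K r p n).addSubgroupOf (Z K r p n)

lemma D_mem_Z (r p n : ℕ) (x : K.Cochain) (hx : x ∈ Z K r p n) : D K x ∈ Z K r (p + r) (n + 1) := by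
  refine ⟨⟨D_deg K n x hx.1.1, hx.2⟩, ?_⟩
  change D K (D K x) ∈ fil K _
  rw [D_D]
  exact zero_mem _

lemma D_mem_B (r p n : ℕ) (hr : 1 ≤ r) (x : K.Cochain) (hx : x ∈ B K r p n) :
    D K x ∈ B K r (p + r) (n + 1) := by
  obtain ⟨y, hy, z, hz, rfl⟩ := AddSubgroup.mem_sup.1 hx
  obtain ⟨⟨w, _, rfl⟩, _⟩ := hz
  rw [map_add, D_D, add_zero]
  refine AddSubgroup.mem_sup_right ⟨⟨y, ⟨?_, ?_⟩, rfl⟩, ?_⟩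
  · exact fun a b h => hy.1.1 a b (by omega)
  · have : p + r + 1 - r = p + 1 := by omega
    rw [this]
    exact hy.1.2
  · have := hy.2
    rw [show p + 1 + (r - 1) = p + r by omega] at this
    exact this

/-- The differential `d_r : E_r^{p,q} → E_r^{p+r,q-r+1}` induced by `D`. -/
def dr (r p n : ℕ) (hr : 1 ≤ r) : E K r p n →+ E K r (p + r) (n + 1) :=
  QuotientAddGroup.map _ _
    (((D K).comp (Z K r p n).subtype).codRestrict _ fun x => D_mem_Z K r p n x x.2)
    fun x hx => D_mem_B K r p n hr x hx

/-- Cocycles of degree `n` of the total complex. -/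
def cocycles (n : ℕ) : AddSubgroup K.Cochain := deg K n ⊓ (D K).ker

/-- Coboundaries of degree `n` of the total complex. -/
def coboundaries (n : ℕ) : AddSubgroup K.Cochain := (degPred K n).map (D K)

/-- The cohomology `H^n` of the total complex. -/
abbrev H (n : ℕ) : Type u := cocycles K n ⧸ (coboundaries K n).addSubgroupOf (cocycles K n)

lemma edge_bot_Z (p : ℕ) : Z K 2 p p ≤ cocycles K p := fun x hx => by
  refine ⟨hx.1.1, ?_⟩
  funext a b
  by_cases h : a < p + 2
  · exact hx.2 a b h
  · exact D_deg K p x hx.1.1 a b (by omega)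

lemma edge_bot_B (p : ℕ) : B K 2 p p ≤ coboundaries K p := by
  refine sup_le (fun x hx => ?_) fun x hx => ?_
  · have : x = 0 := by
      funext a b
      by_cases h : a < p + 1
      · exact hx.1.2 a b h
      · exact hx.1.1 a b (by omega)
    rw [this]
    exact zero_mem _
  · obtain ⟨⟨y, hy, rfl⟩, _⟩ := hx
    exact ⟨y, hy.1, rfl⟩

/-- The edge map `E_2^{p,0} → H^p`: an element of `Z_2^{p,0}` is a cocycle of the total complex. -/
def edgeBot (p : ℕ) : E K 2 p p →+ H K p :=
  QuotientAddGroup.map _ _ (AddSubgroup.inclusion (edge_bot_Z K p)) fun _ hx =>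
    edge_bot_B K p hx

lemma edge_left_Z (n : ℕ) : cocycles K n ≤ Z K 2 0 n := fun x hx => by
  refine ⟨⟨hx.1, fun p q h => absurd h (by omega)⟩, ?_⟩
  change D K x ∈ fil K _
  rw [(hx.2 : D K x = 0)]
  exact zero_mem _

lemma edge_left_B (n : ℕ) : coboundaries K n ≤ B K 2 0 n := by
  rintro _ ⟨y, hy, rfl⟩
  exact AddSubgroup.mem_sup_right ⟨⟨y, ⟨hy, fun p q h => absurd h (by omega)⟩, rfl⟩,
    fun p q h => absurd h (by omega)⟩

/-- The edge map `H^n → E_2^{0,n}`: a cocycle of degree `n` lies in `Z_2^{0,n}`. -/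
def edgeLeft (n : ℕ) : H K n →+ E K 2 0 n :=
  QuotientAddGroup.map _ _ (AddSubgroup.inclusion (edge_left_Z K n)) fun _ hx =>
    edge_left_B K n hx

end DblCpx

section Leray

/-- The double complex `A^{p,q} = Γ(N, 𝒜^p(L^q))` of a complex `L` of sheaves on `N`. -/
def canDbl {N : TopCat.{u}} (L : CochainComplex (AbSheaf N) ℕ) : DblCpx.{u} :=
  ((canSec N).mapHomologicalComplex _).obj L

section Ident
variable {N : TopCat.{u}} (L : CochainComplex (AbSheaf N) ℕ)

lemma canDbl_d₂ (p q : ℕ) (x : (canDbl L).A p q) :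
    (canDbl L).d₂ p q x = (secF N p).map (L.d q (q + 1)) x := rfl

lemma cyc_injective (p q : ℕ) : Function.Injective ((secF N p).map (L.iCycles q)) :=
  (AddCommGrpCat.mono_iff_injective _).1 inferInstance

lemma cyc_range (p q : ℕ) :
    ((canDbl L).d₂ p q).ker ≤ ((secF N p).map (L.iCycles q)).hom.range := by
  intro x hx
  have hS : (ShortComplex.mk (L.iCycles q) (L.d q (q + 1)) (by simp)).Exact :=
    ShortComplex.exact_of_f_is_kernel _ (L.cyclesIsKernel q (q + 1) (by simp))
  obtain ⟨z, hz⟩ := (ShortComplex.ab_exact_iff _).1 (hS.map (secF N p)) x hx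
  exact ⟨z, hz⟩

/-- As `Γ(N, 𝒜^p(-))` is exact, the kernel of `∂̄` on `A^{p,q}` is the group of sections of
`𝒜^p` of the sheaf of cycles of `L^q`. -/
def cycLift (p q : ℕ) : ((canDbl L).d₂ p q).ker →+ (secF N p).obj (L.cycles q) :=
  (AddMonoidHom.ofInjective (f := ((secF N p).map (L.iCycles q)).hom)
    (cyc_injective L p q)).symm.toAddMonoidHom.comp (AddSubgroup.inclusion (cyc_range L p q))

lemma cycLift_spec (p q : ℕ) (x : ((canDbl L).d₂ p q).ker) :
    (secF N p).map (L.iCycles q) (cycLift L p q x) = x.1 :=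
  congrArg Subtype.val ((AddMonoidHom.ofInjective (f := ((secF N p).map (L.iCycles q)).hom)
    (cyc_injective L p q)).apply_symm_apply (AddSubgroup.inclusion (cyc_range L p q) x))

lemma cycLift_unique (p q : ℕ) (x : ((canDbl L).d₂ p q).ker) (z : (secF N p).obj (L.cycles q))
    (hz : (secF N p).map (L.iCycles q) z = x.1) : cycLift L p q x = z :=
  cyc_injective L p q ((cycLift_spec L p q x).trans hz.symm)

/-- The map `ker ∂̄ → Γ(N, 𝒜^p(H^q(L)))` on `ker ∂̄ ⊆ A^{p,q} = Γ(N, 𝒜^p(L^q))`. -/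
def vertClass (p q : ℕ) : ((canDbl L).d₂ p q).ker →+ (secF N p).obj (L.homology q) :=
  ((secF N p).map (L.homologyπ q)).hom.comp (cycLift L p q)

lemma secF_comp {A B C : AbSheaf N} (p : ℕ) (φ : A ⟶ B) (ψ : B ⟶ C) (a : (secF N p).obj A) :
    (secF N p).map ψ ((secF N p).map φ a) = (secF N p).map (φ ≫ ψ) a := by
  rw [Functor.map_comp]; rfl

lemma vertClass_boundary (p q q' : ℕ) (y : (secF N p).obj (L.X q')) (x : ((canDbl L).d₂ p q).ker)
    (hx : x.1 = (secF N p).map (L.d q' q) y) : vertClass L p q x = 0 := by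
  have : cycLift L p q x = (secF N p).map (L.toCycles q' q) y := by
    refine cycLift_unique _ _ _ _ _ ?_
    rw [secF_comp, L.toCycles_i, hx]
  change (secF N p).map (L.homologyπ q) (cycLift L p q x) = 0
  rw [this, secF_comp, L.toCycles_comp_homologyπ, Functor.map_zero]
  rfl

/-- `∂ : Γ(N, 𝒜^p T) → Γ(N, 𝒜^{p+1} T)`. -/
def secD (N : TopCat.{u}) (p : ℕ) (T : AbSheaf N) : (secF N p).obj T →+ (secF N (p + 1)).obj T :=
  (((canSec N).obj T).d p (p + 1)).hom

lemma secD_naturality (p : ℕ) {T T' : AbSheaf N} (φ : T ⟶ T') (t : (secF N p).obj T) :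
    secD N p T' ((secF N p).map φ t) = (secF N (p + 1)).map φ (secD N p T t) :=
  DFunLike.congr_fun (congrArg AddCommGrpCat.Hom.hom (((canSec N).map φ).comm p (p + 1))) t

lemma d₁_mem_ker (p q : ℕ) (x : ((canDbl L).d₂ p q).ker) :
    (canDbl L).d₁ p q x.1 ∈ ((canDbl L).d₂ (p + 1) q).ker := by
  rw [AddMonoidHom.mem_ker, ← DblCpx.d₁_d₂, (AddMonoidHom.mem_ker).1 x.2, map_zero]

lemma vertClass_d₁ (p q : ℕ) (x : ((canDbl L).d₂ p q).ker) :
    secD N p _ (vertClass L p q x) =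
      vertClass L (p + 1) q ⟨(canDbl L).d₁ p q x.1, d₁_mem_ker L p q x⟩ := by
  have : cycLift L (p + 1) q ⟨(canDbl L).d₁ p q x.1, d₁_mem_ker L p q x⟩ =
      secD N p _ (cycLift L p q x) := by
    refine cycLift_unique _ _ _ _ _ ?_
    rw [← secD_naturality, cycLift_spec]
    rfl
  change secD N p _ ((secF N p).map (L.homologyπ q) (cycLift L p q x)) =
    (secF N (p + 1)).map (L.homologyπ q) (cycLift L (p + 1) q _)
  rw [secD_naturality, this]

lemma lead_mem (p q : ℕ) (x : (canDbl L).Cochain) (hx : x ∈ (canDbl L).Z 2 p (p + q)) :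
    x p q ∈ ((canDbl L).d₂ p q).ker := by
  have h := hx.2 p (q + 1) (by omega)
  rw [AddMonoidHom.mem_ker]
  rcases p with _ | p
  · simpa [DblCpx.D, DblCpx.horiz, DblCpx.vert] using h
  · simpa [DblCpx.D, DblCpx.horiz, DblCpx.vert, hx.1.2 p (q + 1) (by omega)] using h

/-- The component `x^{p,q}` of an element of `Z_2^{p,q}`. -/
def lead (p q : ℕ) : (canDbl L).Z 2 p (p + q) →+ ((canDbl L).d₂ p q).ker where
  toFun x := ⟨x.1 p q, lead_mem L p q x.1 x.2⟩
  map_zero' := rfl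
  map_add' _ _ := rfl

lemma lead_cocycle (p q : ℕ) (x : (canDbl L).Z 2 p (p + q)) :
    secD N p _ (vertClass L p q (lead L p q x)) = 0 := by
  rw [vertClass_d₁]
  have h := x.2.2 (p + 1) q (by omega)
  rcases q with _ | q
  · have h0 : (canDbl L).d₁ p 0 (x.1 p 0) = 0 := by
      have h1 : (-1 : ℤ) ^ p • (canDbl L).d₁ p 0 (x.1 p 0) = 0 := by
        simpa [DblCpx.D, DblCpx.horiz, DblCpx.vert] using h
      rcases neg_one_pow_eq_or ℤ p with h2 | h2 <;> rw [h2] at h1 <;> simpa using h1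
    exact vertClass_boundary L (p + 1) 0 0 (0 : (secF N (p + 1)).obj (L.X 0)) _
      (h0.trans (map_zero ((secF N (p + 1)).map (L.d 0 0)).hom).symm)
  · have h1 : (-1 : ℤ) ^ (p + (q + 1)) • (canDbl L).d₁ p (q + 1) (x.1 p (q + 1)) +
        (canDbl L).d₂ (p + 1) q (x.1 (p + 1) q) = 0 := h
    rcases neg_one_pow_eq_or ℤ (p + (q + 1)) with h2 | h2
    · rw [h2, one_smul] at h1
      exact vertClass_boundary L (p + 1) (q + 1) q
        (-(x.1 (p + 1) q : (secF N (p + 1)).obj (L.X q)) : (secF N (p + 1)).obj (L.X q)) _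
        ((eq_neg_of_add_eq_zero_left h1).trans
          (map_neg ((secF N (p + 1)).map (L.d q (q + 1))).hom _).symm)
    · refine vertClass_boundary L (p + 1) (q + 1) q (x.1 (p + 1) q) _ ?_
      rw [h2, neg_one_smul, neg_add_eq_zero] at h1
      exact h1

/-- A cocycle of `C`, as an element of the object of cycles. -/
def toCyc (C : CochainComplex AddCommGrpCat.{u} ℕ) (n : ℕ) :
    (C.d n (n + 1)).hom.ker →+ C.cycles n :=
  (C.liftCycles (AddCommGrpCat.ofHom (C.d n (n + 1)).hom.ker.subtype) (n + 1) (by simp)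
    (by ext x; exact x.2)).hom

lemma iCycles_toCyc (C : CochainComplex AddCommGrpCat.{u} ℕ) (n : ℕ)
    (x : (C.d n (n + 1)).hom.ker) : C.iCycles n (toCyc C n x) = x.1 :=
  DFunLike.congr_fun (congrArg AddCommGrpCat.Hom.hom (C.liftCycles_i
    (AddCommGrpCat.ofHom (C.d n (n + 1)).hom.ker.subtype) (n + 1) (by simp)
    (by ext x; exact x.2))) x

/-- The class of a cocycle. -/
def classHom (C : CochainComplex AddCommGrpCat.{u} ℕ) (n : ℕ) :
    (C.d n (n + 1)).hom.ker →+ C.homology n :=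
  (C.homologyπ n).hom.comp (toCyc C n)

lemma classHom_boundary (C : CochainComplex AddCommGrpCat.{u} ℕ) (m n : ℕ)
    (x : (C.d n (n + 1)).hom.ker) (y : C.X m) (hy : C.d m n y = x.1) : classHom C n x = 0 := by
  have h : toCyc C n x = C.toCycles m n y := by
    apply (AddCommGrpCat.mono_iff_injective (C.iCycles n)).1 inferInstance
    refine (iCycles_toCyc C n x).trans (hy.symm.trans ?_)
    exact (DFunLike.congr_fun (congrArg AddCommGrpCat.Hom.hom (C.toCycles_i m n)) y).symm
  change C.homologyπ n (toCyc C n x) = 0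
  rw [h]
  exact DFunLike.congr_fun (congrArg AddCommGrpCat.Hom.hom (C.toCycles_comp_homologyπ m n)) y

/-- The map `Z_2^{p,q} → H^p(N, H^q(L))` which sends `x` to the class of `x^{p,q}`, first in
`Γ(N, 𝒜^p(H^q(L)))` and then in the cohomology of this complex in `p`. -/
def identZ (p q : ℕ) : (canDbl L).Z 2 p (p + q) →+ (coh N p).obj (L.homology q) :=
  (classHom ((canSec N).obj (L.homology q)) p).comp
    (((vertClass L p q).comp (lead L p q)).codRestrict _ (lead_cocycle L p q))

lemma identZ_B (p q : ℕ) (x : (canDbl L).Z 2 p (p + q))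
    (hx : x.1 ∈ (canDbl L).B 2 p (p + q)) : identZ L p q x = 0 := by
  obtain ⟨a, ha, _, ⟨⟨y, hy, rfl⟩, hb⟩, hab⟩ := AddSubgroup.mem_sup.1 hx
  have ha0 : a p q = 0 := ha.1.2 p q (by omega)
  have hxpq : x.1 p q = (canDbl L).D y p q := by
    rw [← hab]
    simp [ha0]
  rcases p with _ | p
  · have h0 : vertClass L 0 q (lead L 0 q x) = 0 := by
      rcases q with _ | q
      · have h1 : lead L 0 0 x = 0 := Subtype.ext (hxpq.trans (add_zero (0 : (canDbl L).A 0 0)))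
        rw [h1, map_zero]
      · exact vertClass_boundary L 0 (q + 1) q (y 0 q) _
          (hxpq.trans (by simp [DblCpx.D, DblCpx.horiz, DblCpx.vert]; rfl))
    refine Eq.trans (congrArg (classHom ((canSec N).obj (L.homology q)) 0)
      (a₂ := 0) (Subtype.ext h0)) (map_zero _)
  · have hker : y p q ∈ ((canDbl L).d₂ p q).ker := by
      have h := hb p (q + 1) (by omega)
      rw [AddMonoidHom.mem_ker]
      rcases p with _ | p
      · simpa [DblCpx.D, DblCpx.horiz, DblCpx.vert] using h
      · simpa [DblCpx.D, DblCpx.horiz, DblCpx.vert, hy.2 p (q + 1) (by omega)] using h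
    have hD : ∃ w : ((canDbl L).d₂ (p + 1) q).ker, vertClass L (p + 1) q w = 0 ∧
        lead L (p + 1) q x = (-1 : ℤ) ^ (p + q) •
          (⟨(canDbl L).d₁ p q (y p q), d₁_mem_ker L p q ⟨_, hker⟩⟩ :
            ((canDbl L).d₂ (p + 1) q).ker) + w := by
      rcases q with _ | q
      · refine ⟨0, map_zero _, Subtype.ext (hxpq.trans ?_)⟩
        simp [DblCpx.D, DblCpx.horiz, DblCpx.vert]
      · refine ⟨⟨(canDbl L).d₂ (p + 1) q (y (p + 1) q), DblCpx.d₂_d₂ _ _ _ _⟩,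
          vertClass_boundary L (p + 1) (q + 1) q (y (p + 1) q) _ rfl, Subtype.ext (hxpq.trans ?_)⟩
        simp [DblCpx.D, DblCpx.horiz, DblCpx.vert]
    obtain ⟨w, hw, hl⟩ := hD
    refine classHom_boundary ((canSec N).obj (L.homology q)) p (p + 1) _
      ((-1 : ℤ) ^ (p + q) • vertClass L p q ⟨_, hker⟩) ?_
    refine (map_zsmul (secD N p (L.homology q)) _ _).trans ?_
    rw [vertClass_d₁]
    change _ = vertClass L (p + 1) q (lead L (p + 1) q x)
    rw [hl, map_add, hw, add_zero, map_zsmul]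

/-- The canonical map `E_2^{p,q} → H^p(N, H^q(L))` induced by `identZ`. -/
def ident (p q : ℕ) : (canDbl L).E 2 p (p + q) →+ (coh N p).obj (L.homology q) :=
  QuotientAddGroup.lift _ (identZ L p q) fun x hx => identZ_B L p q x hx

end Ident
end Leray

section Aug
variable {N : TopCat.{u}} (L : CochainComplex (AbSheaf N) ℕ)

/-- The complex of global sections of a complex of sheaves. -/
abbrev globCpx : CochainComplex AddCommGrpCat.{u} ℕ := ((glob N).mapHomologicalComplex _).obj L

/-- The map `Γ(N, L^n) → Γ(N, 𝒜⁰(L^n)) = A^{0,n}`. -/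
def augSec (n : ℕ) : (globCpx L).X n →+ (canDbl L).A 0 n :=
  ((glob N).map (discUnit (L.X n))).hom

lemma d₁_augSec (n : ℕ) (s : (globCpx L).X n) : (canDbl L).d₁ 0 n (augSec L n s) = 0 := by
  have h : discUnit (L.X n) ≫ (canResObj (L.X n)).d 0 1 = 0 := by
    have := canResObj_d (L.X n) 0
    rw [this]
    change discUnit (L.X n) ≫ quotπ (L.X n) ≫ discUnit _ = 0
    rw [← Category.assoc, discUnit_quotπ, zero_comp]
  exact DFunLike.congr_fun (congrArg AddCommGrpCat.Hom.hom
    (((glob N).map_comp _ _).symm.trans (congrArg (glob N).map h))) s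

lemma d₂_augSec (n : ℕ) (s : (globCpx L).X n) :
    (canDbl L).d₂ 0 n (augSec L n s) = augSec L (n + 1) ((globCpx L).d n (n + 1) s) :=
  (DFunLike.congr_fun (congrArg AddCommGrpCat.Hom.hom
    (congrArg (glob N).map (discUnit_naturality (L.d n (n + 1))))) s).symm

/-- The map `Γ(N, L^n) → A^{0,n} ⊆ A^n`. -/
def augCochain (n : ℕ) : (globCpx L).X n →+ (canDbl L).Cochain where
  toFun s := Pi.single 0 (Pi.single n (augSec L n s))
  map_zero' := by simp
  map_add' s t := by simp [Pi.single_add]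

lemma augCochain_self (n : ℕ) (s : (globCpx L).X n) : augCochain L n s 0 n = augSec L n s := by
  simp [augCochain]

lemma augCochain_ne (n : ℕ) (s : (globCpx L).X n) (q : ℕ) (h : q ≠ n) :
    augCochain L n s 0 q = 0 := by
  simp [augCochain, h]

lemma augCochain_succ (n : ℕ) (s : (globCpx L).X n) (p q : ℕ) :
    augCochain L n s (p + 1) q = 0 := by
  simp [augCochain]

lemma D_augCochain (n : ℕ) (s : (globCpx L).X n) :
    (canDbl L).D (augCochain L n s) = augCochain L (n + 1) ((globCpx L).d n (n + 1) s) := by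
  funext p q
  have hv : (canDbl L).vert (augCochain L n s) p q =
      augCochain L (n + 1) ((globCpx L).d n (n + 1) s) p q := by
    rcases p with _ | p
    · rcases q with _ | q
      · rw [augCochain_ne _ _ _ _ (by omega)]; rfl
      · by_cases h : q = n
        · subst h
          rw [augCochain_self, ← d₂_augSec, ← augCochain_self]; rfl
        · rw [augCochain_ne _ _ _ _ (by omega)]
          exact (congrArg _ (augCochain_ne L n s q h)).trans (map_zero _)
    · rw [augCochain_succ]
      rcases q with _ | q
      · rfl
      · exact (congrArg _ (augCochain_succ L n s p q)).trans (map_zero _)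
  have hh : (canDbl L).horiz (augCochain L n s) p q = 0 := by
    rcases p with _ | p
    · rfl
    · change (-1 : ℤ) ^ (p + q) • (canDbl L).d₁ p q (augCochain L n s p q) = 0
      rcases p with _ | p
      · by_cases h : q = n
        · subst h
          rw [augCochain_self, d₁_augSec, smul_zero]
        · rw [augCochain_ne _ _ _ _ h, map_zero, smul_zero]
      · rw [augCochain_succ, map_zero, smul_zero]
  change (canDbl L).horiz (augCochain L n s) p q + (canDbl L).vert (augCochain L n s) p q = _
  rw [hh, hv, zero_add]

lemma augCochain_deg (n : ℕ) (s : (globCpx L).X n) : augCochain L n s ∈ (canDbl L).deg n := by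
  intro p q h
  rcases p with _ | p
  · exact augCochain_ne L n s q (by omega)
  · exact augCochain_succ L n s p q

/-- The cohomology class in the total complex of a cycle of `Γ(N, L^n)`. -/
def augCyc (n : ℕ) : (globCpx L).cycles n →+ (canDbl L).H n :=
  (QuotientAddGroup.mk' _).comp
    (((augCochain L n).comp ((globCpx L).iCycles n).hom).codRestrict ((canDbl L).cocycles n)
      fun z => ⟨augCochain_deg L n _, (D_augCochain L n _).trans (by
        have : (globCpx L).d n (n + 1) ((globCpx L).iCycles n z) = 0 :=
          DFunLike.congr_fun (congrArg AddCommGrpCat.Hom.hom ((globCpx L).iCycles_d n (n + 1))) z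
        exact (congrArg _ this).trans (map_zero _))⟩)

lemma augCyc_boundary (n : ℕ) :
    (globCpx L).toCycles ((ComplexShape.up ℕ).prev n) n ≫ AddCommGrpCat.ofHom (augCyc L n) = 0 := by
  ext s
  refine (QuotientAddGroup.eq_zero_iff _).2 ?_
  change augCochain L n ((globCpx L).iCycles n ((globCpx L).toCycles _ n s)) ∈
    (canDbl L).coboundaries n
  have hs : (globCpx L).iCycles n ((globCpx L).toCycles _ n s) = (globCpx L).d _ n s :=
    DFunLike.congr_fun (congrArg AddCommGrpCat.Hom.hom ((globCpx L).toCycles_i _ n)) s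
  rw [hs]
  rcases n with _ | m
  · have : (globCpx L).d ((ComplexShape.up ℕ).prev 0) 0 = 0 :=
      HomologicalComplex.shape _ _ _ (by simp)
    rw [this]
    exact (map_zero (augCochain L 0)).symm ▸ zero_mem _
  · have hm : (ComplexShape.up ℕ).prev (m + 1) = m := by simp
    revert s
    rw [hm]
    intro s _
    exact ⟨augCochain L m s, fun p q h => augCochain_deg L m s p q (by omega), D_augCochain L m s⟩

/-- The augmentation map `H^n(Γ(N, L^•)) → H^n` into the cohomology of the total complex. -/
def aug (n : ℕ) : (globCpx L).homology n →+ (canDbl L).H n :=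
  (((globCpx L).homologyIsCokernel _ n rfl).desc
    (CokernelCofork.ofπ (AddCommGrpCat.ofHom (augCyc L n)) (augCyc_boundary L n))).hom

end Aug

/-- `f_*` on sheaves of abelian groups. -/
abbrev push {M N : TopCat.{u}} (f : M ⟶ N) : AbSheaf M ⥤ AbSheaf N :=
  TopCat.Sheaf.pushforward AddCommGrpCat.{u} f

instance {M N : TopCat.{u}} (f : M ⟶ N) : (push f).Additive where
  map_add := rfl

/-- The complex `f_* 𝒜^•(S)` of sheaves on `N`. -/
def directImageCpx {M N : TopCat.{u}} (f : M ⟶ N) (S : AbSheaf M) :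
    CochainComplex (AbSheaf N) ℕ :=
  ((push f).mapHomologicalComplex _).obj ((canRes M).obj S)

/-- The higher direct image `R^q f_* S`, the `q`-th cohomology sheaf of `f_* 𝒜^•(S)`. -/
def directImage {M N : TopCat.{u}} (f : M ⟶ N) (S : AbSheaf M) (q : ℕ) : AbSheaf N :=
  (directImageCpx f S).homology q

section RestrictionMaps
variable {X' X : TopCat.{u}} {j : X' ⟶ X} (hj : IsOpenEmbedding j)

/-- Restriction of global sections `Γ(X, T) → Γ(X', T|_{X'})`. -/
def resGlob : glob X ⟶ res hj ⋙ glob X' where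
  app T := T.obj.map (homOfLE le_top : hj.functor.obj ⊤ ⟶ ⊤).op
  naturality _ _ φ := (φ.hom.naturality _).symm

/-- Restriction `Γ(X, 𝒜^•(T)) → Γ(X', 𝒜^•(T)|_{X'}) → Γ(X', 𝒜^•(T|_{X'}))`. -/
def resSec (T : AbSheaf X) :
    (canSec X).obj T ⟶ (canSec X').obj ((res hj).obj T) :=
  (NatTrans.mapHomologicalComplex (resGlob hj) _).app ((canRes X).obj T) ≫
    ((glob X').mapHomologicalComplex _).map (resCanRes hj T)

/-- The restriction map `H^n(X, T) → H^n(X', T|_{X'})`. -/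
def resCoh (n : ℕ) (T : AbSheaf X) : (coh X n).obj T ⟶ (coh X' n).obj ((res hj).obj T) :=
  HomologicalComplex.homologyMap (resSec hj T) n

end RestrictionMaps

section BaseChange
variable {M N M' N' : TopCat.{u}} {f : M ⟶ N} {f' : M' ⟶ N'} {j : M' ⟶ M} {i : N' ⟶ N}
  (hj : IsOpenEmbedding j) (hi : IsOpenEmbedding i) (w : j ≫ f = f' ≫ i)

lemma image_le (w : j ≫ f = f' ≫ i) (V : Opens N') :
    hj.functor.obj ((Opens.map f').obj V) ≤ (Opens.map f).obj (hi.functor.obj V) := by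
  rintro _ ⟨x, hx, rfl⟩
  exact ⟨f' x, hx, (ConcreteCategory.congr_hom w x).symm⟩

/-- For a commutative square `f ∘ j = i ∘ f'` with open embeddings `i` and `j`, the natural map
`(f_* F)|_{N'} → f'_* (F|_{M'})`, which on `V` is the restriction `F(f⁻¹(i(V))) → F(j(f'⁻¹(V)))`.
It is an identity map in case that `M'` is the full preimage of `N'`. -/
def baseChange : push f ⋙ res hi ⟶ res hj ⋙ push f' where
  app F := ⟨{ app := fun V => F.obj.map (homOfLE (image_le hj hi w V.unop)).op
              naturality := fun U V k => by
                change F.obj.map _ ≫ F.obj.map _ = F.obj.map _ ≫ F.obj.map _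
                rw [← F.obj.map_comp, ← F.obj.map_comp]
                rfl }⟩
  naturality F G φ := by
    refine ObjectProperty.hom_ext _ (NatTrans.ext (funext fun V => ?_))
    exact (φ.hom.naturality _).symm

/-- The canonical map `(f_* 𝒜^•(S))|_{N'} → f'_* (𝒜^•(S)|_{M'}) → f'_* 𝒜^•(S|_{M'})`. -/
def directImageCpxRes (S : AbSheaf M) :
    ((res hi).mapHomologicalComplex _).obj (directImageCpx f S) ⟶
      directImageCpx f' ((res hj).obj S) :=
  (NatTrans.mapHomologicalComplex (baseChange hj hi w) _).app ((canRes M).obj S) ≫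
    ((push f').mapHomologicalComplex _).map (resCanRes hj S)

/-- The canonical map `(R^q f_* S)|_{N'} → R^q f'_* (S|_{M'})` induced by `directImageCpxRes` on
cohomology sheaves. -/
def directImageRes (S : AbSheaf M) (q : ℕ) :
    (res hi).obj (directImage f S q) ⟶ directImage f' ((res hj).obj S) q :=
  (((directImageCpx f S).sc q).mapHomologyIso (res hi)).inv ≫
    HomologicalComplex.homologyMap (directImageCpxRes hj hi w S) q

end BaseChange

section FiveTerm
variable {M N : TopCat.{u}} (f : M ⟶ N) (S : AbSheaf M)

/-- The double complex `A^{p,q} = Γ(N, 𝒜^p(f_* 𝒜^q(S)))`. The spectral sequence of its first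
filtration is the Leray spectral sequence of `f` and `S`. -/
def lerayDbl : DblCpx.{u} := canDbl (directImageCpx f S)

/-- The group `H^p(N, R^q f_* S)`. -/
abbrev E₂ (p q : ℕ) : AddCommGrpCat.{u} := (coh N p).obj (directImage f S q)

/-- The canonical map from the second term of the spectral sequence of the double complex to
`H^p(N, R^q f_* S)`. -/
def lerayIdent (p q : ℕ) : (lerayDbl f S).E 2 p (p + q) →+ E₂ f S p q :=
  ident (directImageCpx f S) p q

/-- The canonical map from `H^n(M, S)`, the cohomology of `Γ(M, 𝒜^•(S)) = Γ(N, f_* 𝒜^•(S))`, to the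
cohomology of the total complex. -/
def lerayAug (n : ℕ) : (coh M n).obj S →+ (lerayDbl f S).H n :=
  aug (directImageCpx f S) n

/-- The spectral sequence of the double complex is of the form
`E_2^{p,q} = H^p(N, R^q f_* S) ⇒ H^{p+q}(M, S)`: the canonical maps which identify the second terms
and the limit are bijective. -/
structure IsLeray : Prop where
  ident_bijective : ∀ p q, Function.Bijective (lerayIdent f S p q)
  aug_bijective : ∀ n, Function.Bijective (lerayAug f S n)

namespace IsLeray
variable {f S} (h : IsLeray f S)

/-- The identification of the second term of the spectral sequence with `H^p(N, R^q f_* S)`. -/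
def identEquiv (p q : ℕ) : (lerayDbl f S).E 2 p (p + q) ≃+ E₂ f S p q :=
  AddEquiv.ofBijective _ (h.ident_bijective p q)

/-- The identification of `H^n(M, S)` with the cohomology of the total complex. -/
def augEquiv (n : ℕ) : (coh M n).obj S ≃+ (lerayDbl f S).H n :=
  AddEquiv.ofBijective _ (h.aug_bijective n)

/-- The edge map `E_2^{1,0} → H^1(M, S)`. -/
def map₁ : E₂ f S 1 0 →+ (coh M 1).obj S :=
  (h.augEquiv 1).symm.toAddMonoidHom.comp
    (((lerayDbl f S).edgeBot 1).comp (h.identEquiv 1 0).symm.toAddMonoidHom)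

/-- The edge map `H^1(M, S) → E_2^{0,1}`. -/
def map₂ : (coh M 1).obj S →+ E₂ f S 0 1 :=
  (h.identEquiv 0 1).toAddMonoidHom.comp
    (((lerayDbl f S).edgeLeft 1).comp (h.augEquiv 1).toAddMonoidHom)

/-- The differential `d_2 : E_2^{0,1} → E_2^{2,0}`. -/
def map₃ : E₂ f S 0 1 →+ E₂ f S 2 0 :=
  (h.identEquiv 2 0).toAddMonoidHom.comp
    (((lerayDbl f S).dr 2 0 1 one_le_two).comp (h.identEquiv 0 1).symm.toAddMonoidHom)

/-- The edge map `E_2^{2,0} → H^2(M, S)`. -/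
def map₄ : E₂ f S 2 0 →+ (coh M 2).obj S :=
  (h.augEquiv 2).symm.toAddMonoidHom.comp
    (((lerayDbl f S).edgeBot 2).comp (h.identEquiv 2 0).symm.toAddMonoidHom)

/-- Exactness of `0 → E_2^{1,0} → H^1(M, S) → E_2^{0,1} → E_2^{2,0} → H^2(M, S)`. -/
structure FiveTermExact : Prop where
  injective₁ : Function.Injective h.map₁
  exact₁₂ : Function.Exact h.map₁ h.map₂
  exact₂₃ : Function.Exact h.map₂ h.map₃
  exact₃₄ : Function.Exact h.map₃ h.map₄

end IsLeray

end FiveTerm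

section Open
variable {M N : TopCat.{u}} (f : M ⟶ N) (S : AbSheaf M) (N' : Opens N)

/-- The open subset `M' = f⁻¹(N')` of `M`. -/
abbrev preOpen : Opens M := (Opens.map f).obj N'

/-- The restriction `f' : M' → N'` of `f`. -/
def resMap : (Opens.toTopCat M).obj (preOpen f N') ⟶ (Opens.toTopCat N).obj N' :=
  TopCat.ofHom ⟨fun x => ⟨f x.1, x.2⟩, by fun_prop⟩

lemma resMap_comm : (preOpen f N').inclusion' ≫ f = resMap f N' ≫ N'.inclusion' := rfl

/-- Restriction `T ↦ T|_U` of sheaves to an open subset. -/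
abbrev restrict {X : TopCat.{u}} (U : Opens X) : AbSheaf X ⥤ AbSheaf ((Opens.toTopCat X).obj U) :=
  res U.isOpenEmbedding

/-- The restriction map `H^n(X, T) → H^n(U, T|_U)`. -/
def resH {X : TopCat.{u}} (U : Opens X) (n : ℕ) (T : AbSheaf X) :
    (coh X n).obj T →+ (coh ((Opens.toTopCat X).obj U) n).obj ((restrict U).obj T) :=
  (resCoh U.isOpenEmbedding n T).hom

/-- The canonical map `(R^q f_* S)|_{N'} → R^q f'_* (S|_{M'})`. -/
def directImageRestrict (q : ℕ) : (restrict N').obj (directImage f S q) ⟶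
    directImage (resMap f N') ((restrict (preOpen f N')).obj S) q :=
  directImageRes (preOpen f N').isOpenEmbedding N'.isOpenEmbedding (resMap_comm f N') S q

/-- The map `H^p(N, R^q f_* S) → H^p(N', (R^q f_* S)|_{N'}) → H^p(N', R^q f'_* (S|_{M'}))`, the
restriction from `N` to `N'` followed by the map induced by `directImageRestrict`. -/
def resE₂ (p q : ℕ) :
    E₂ f S p q →+ E₂ (resMap f N') ((restrict (preOpen f N')).obj S) p q :=
  ((coh _ p).map (directImageRestrict f S N' q)).hom.comp (resH N' p (directImage f S q))

end Open
end LerayFive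

end

open LerayFive

/-!
The statement splits into a formal part, about the spectral sequence of any first quadrant double
complex, and two geometric inputs, about the canonical resolution.

*Formal part.* With the explicit groups `Z_r` and `B_r`, exactness of the five-term sequence of a
double complex is a direct inspection of elements (`DblCpx.exact_edgeLeft_dr` and its neighbours).
A morphism of double complexes commutes with the total differentials and respects the filtrations, so
that it commutes with edge maps and differentials (`DblCpx.mapE_dr`, `DblCpx.mapE_edgeLeft`,
`DblCpx.mapH_edgeBot`).

*The second terms.* For any complex `L` of sheaves on `N`, the functors `Γ(N, 𝒜^p(-))` are exact, so
that the vertical cohomology of `Γ(N, 𝒜^p(L^q))` is `Γ(N, 𝒜^p(H^q(L)))`; a class of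
`H^p(N, H^q(L))` lifts to a family with components in the bidegrees `(p, q)` and `(p + 1, q - 1)`
only. This gives `ident_bijective`.

*The limit.* The augmentation `H^n(Γ(N, L^•)) → H^n` is bijective as soon as the rows
`0 → Γ(N, L^q) → Γ(N, 𝒜^0(L^q)) → Γ(N, 𝒜^1(L^q)) → ⋯` are exact (`aug_bijective`). For
`L^q = f_* 𝒜^q(S)` no flasqueness argument is needed: evaluating germs at points gives a retraction of
`f_* 𝒜⁰(T) → 𝒜⁰(f_* 𝒜⁰(T))`, and the class of the sheaves `T` for which `T → 𝒜⁰(T)` is a split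
monomorphism is stable under `ℬ¹`, because `ℬ¹(T)` is then a direct summand of `𝒜⁰(T)`. The canonical
resolution of such a sheaf is built from split exact sequences, and these stay exact under `Γ(N, -)`.

*Restriction.* The canonical resolution commutes with restriction to open subsets
(`isIso_resCanRes`), since its construction involves only stalks and cokernels; as `M'` is the full
preimage of `N'`, so does `f_*`, and this gives `isIso_directImageRestrict`. Restriction yields a
morphism `lerayDblRes` between the two double complexes, which corresponds to the restriction maps of the
statement under the identifications of the second terms and of the limits (`lerayIdent_mapE`,
`lerayAug_resH`).
-/

noncomputable section

namespace LerayFive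

namespace DblCpx

/-! ### The five-term exact sequence of a double complex -/

section FiveTerm

variable (K : DblCpx.{u})

lemma edgeBot_one_injective : Function.Injective (K.edgeBot 1) := by
  rw [injective_iff_map_eq_zero]
  intro e he
  obtain ⟨x, rfl⟩ := QuotientAddGroup.mk_surjective e
  obtain ⟨y, hy, hyx⟩ := (QuotientAddGroup.eq_zero_iff _).1 he
  have hyx : K.D y = x.1 := hyx
  refine (QuotientAddGroup.eq_zero_iff _).2 (AddSubgroup.mem_sup_right ⟨?_, x.2.1.2⟩)
  exact ⟨y, ⟨hy, fun p q h => absurd h (by omega)⟩, hyx⟩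

lemma exact_edgeBot_edgeLeft : Function.Exact (K.edgeBot 1) (K.edgeLeft 1) := by
  intro e
  obtain ⟨x, rfl⟩ := QuotientAddGroup.mk_surjective e
  constructor
  · intro he
    have hx : x.1 ∈ K.B 2 0 1 :=
      (QuotientAddGroup.eq_zero_iff (AddSubgroup.inclusion (K.edge_left_Z 1) x)).1 he
    obtain ⟨a, ha, _, ⟨⟨y, hy, rfl⟩, _⟩, hab⟩ := AddSubgroup.mem_sup.1 hx
    have hDa : K.D a = 0 := by
      have := congrArg K.D hab
      rwa [map_add, D_D, add_zero, (x.2.2 : K.D x.1 = 0)] at this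
    refine ⟨QuotientAddGroup.mk ⟨a, ha.1, ?_⟩, ?_⟩
    · change K.D a ∈ K.fil _
      rw [hDa]
      exact zero_mem _
    · refine QuotientAddGroup.eq.2 ⟨y, hy.1, ?_⟩
      change K.D y = -a + x.1
      rw [← hab, neg_add_cancel_left]
  · rintro ⟨e', he'⟩
    rw [← he']
    obtain ⟨x', rfl⟩ := QuotientAddGroup.mk_surjective e'
    refine (QuotientAddGroup.eq_zero_iff _).2 (AddSubgroup.mem_sup_left ⟨x'.2.1, ?_⟩)
    exact fun p q h => x'.2.2 p q (by omega)

lemma exact_edgeLeft_dr : Function.Exact (K.edgeLeft 1) (K.dr 2 0 1 one_le_two) := by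
  intro e
  obtain ⟨x, rfl⟩ := QuotientAddGroup.mk_surjective e
  constructor
  · intro he
    have hx : K.D x.1 ∈ K.B 2 2 2 :=
      (QuotientAddGroup.eq_zero_iff (⟨K.D x.1, K.D_mem_Z 2 0 1 x.1 x.2⟩ : K.Z 2 2 2)).1 he
    obtain ⟨a, ha, _, ⟨⟨y, hy, rfl⟩, hyf⟩, hab⟩ := AddSubgroup.mem_sup.1 hx
    -- degree `2` and filtration `3` leave no room for a nonzero component
    have ha0 : a = 0 := by
      funext p q
      by_cases h : p < 3
      · exact ha.1.2 p q h
      · exact ha.1.1 p q (by omega)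
    rw [ha0, zero_add] at hab
    have hy1 : y ∈ K.deg 1 := fun p q h => hy.1 p q (by omega)
    refine ⟨QuotientAddGroup.mk ⟨x.1 - y, (K.deg 1).sub_mem x.2.1.1 hy1, ?_⟩, ?_⟩
    · change K.D (x.1 - y) = 0
      rw [map_sub, hab, sub_self]
    · refine QuotientAddGroup.eq.2 (AddSubgroup.mem_sup_left ⟨⟨?_, ?_⟩, ?_⟩)
      · change -(x.1 - y) + x.1 ∈ K.deg 1
        simpa using hy1
      · change -(x.1 - y) + x.1 ∈ K.fil 1
        simpa using hy.2
      · change K.D (-(x.1 - y) + x.1) ∈ K.fil 2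
        simpa using hyf
  · rintro ⟨e', he'⟩
    rw [← he']
    obtain ⟨x', rfl⟩ := QuotientAddGroup.mk_surjective e'
    refine (QuotientAddGroup.eq_zero_iff _).2 ?_
    change K.D x'.1 ∈ K.B 2 2 2
    rw [(x'.2.2 : K.D x'.1 = 0)]
    exact zero_mem _

lemma exact_dr_edgeBot : Function.Exact (K.dr 2 0 1 one_le_two) (K.edgeBot 2) := by
  intro e
  obtain ⟨x, rfl⟩ := QuotientAddGroup.mk_surjective e
  constructor
  · intro he
    obtain ⟨y, hy, hyx⟩ := (QuotientAddGroup.eq_zero_iff _).1 he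
    have hyx : K.D y = x.1 := hyx
    refine ⟨QuotientAddGroup.mk ⟨y, ⟨fun p q h => hy p q (by omega),
      fun p q h => absurd h (by omega)⟩, ?_⟩, ?_⟩
    · change K.D y ∈ K.fil 2
      rw [hyx]
      exact x.2.1.2
    · exact congrArg QuotientAddGroup.mk (Subtype.ext hyx)
  · rintro ⟨e', he'⟩
    rw [← he']
    obtain ⟨x', rfl⟩ := QuotientAddGroup.mk_surjective e'
    exact (QuotientAddGroup.eq_zero_iff _).2 ⟨x'.1, fun p q h => x'.2.1.1 p q (by omega), rfl⟩

end FiveTerm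

/-! ### Functoriality of the spectral sequence in the double complex -/

section Map

variable {K K' : DblCpx.{u}} (φ : K ⟶ K')

/-- The map on families of elements induced by a morphism of double complexes. -/
def mapCochain : K.Cochain →+ K'.Cochain where
  toFun x p q := (φ.f q).f p (x p q)
  map_zero' := funext fun p => funext fun q => map_zero ((φ.f q).f p).hom
  map_add' x y := funext fun p => funext fun q => map_add ((φ.f q).f p).hom (x p q) (y p q)

lemma d₁_map (p q : ℕ) (a : K.A p q) :
    K'.d₁ p q ((φ.f q).f p a) = (φ.f q).f (p + 1) (K.d₁ p q a) :=
  DFunLike.congr_fun (congrArg AddCommGrpCat.Hom.hom ((φ.f q).comm p (p + 1))) a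

lemma d₂_map (p q : ℕ) (a : K.A p q) :
    K'.d₂ p q ((φ.f q).f p a) = (φ.f (q + 1)).f p (K.d₂ p q a) :=
  DFunLike.congr_fun (congrArg AddCommGrpCat.Hom.hom
    (congrArg (fun ψ => HomologicalComplex.Hom.f ψ p) (φ.comm q (q + 1)))) a

lemma D_mapCochain (x : K.Cochain) : K'.D (mapCochain φ x) = mapCochain φ (K.D x) := by
  funext p q
  change K'.horiz (mapCochain φ x) p q + K'.vert (mapCochain φ x) p q =
    ((φ.f q).f p).hom (K.horiz x p q + K.vert x p q)
  rw [map_add]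
  congr 1
  · rcases p with _ | p
    · exact (map_zero ((φ.f q).f 0).hom).symm
    · exact (congrArg _ (d₁_map φ p q (x p q))).trans
        (map_zsmul ((φ.f q).f (p + 1)).hom _ _).symm
  · rcases q with _ | q
    · exact (map_zero ((φ.f 0).f p).hom).symm
    · exact d₂_map φ p q (x p q)

lemma mapCochain_deg {n : ℕ} {x : K.Cochain} (hx : x ∈ K.deg n) : mapCochain φ x ∈ K'.deg n :=
  fun p q h => (congrArg ((φ.f q).f p) (hx p q h)).trans (map_zero ((φ.f q).f p).hom)

lemma mapCochain_degPred {n : ℕ} {x : K.Cochain} (hx : x ∈ K.degPred n) :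
    mapCochain φ x ∈ K'.degPred n :=
  fun p q h => (congrArg ((φ.f q).f p) (hx p q h)).trans (map_zero ((φ.f q).f p).hom)

lemma mapCochain_fil {i : ℕ} {x : K.Cochain} (hx : x ∈ K.fil i) : mapCochain φ x ∈ K'.fil i :=
  fun p q h => (congrArg ((φ.f q).f p) (hx p q h)).trans (map_zero ((φ.f q).f p).hom)

lemma mapCochain_Z {r p n : ℕ} {x : K.Cochain} (hx : x ∈ K.Z r p n) :
    mapCochain φ x ∈ K'.Z r p n := by
  refine ⟨⟨mapCochain_deg φ hx.1.1, mapCochain_fil φ hx.1.2⟩, ?_⟩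
  change K'.D _ ∈ K'.fil _
  rw [D_mapCochain]
  exact mapCochain_fil φ hx.2

lemma mapCochain_B {r p n : ℕ} {x : K.Cochain} (hx : x ∈ K.B r p n) :
    mapCochain φ x ∈ K'.B r p n := by
  obtain ⟨a, ha, _, ⟨⟨y, hy, rfl⟩, hyf⟩, rfl⟩ := AddSubgroup.mem_sup.1 hx
  rw [map_add]
  refine AddSubgroup.add_mem_sup (mapCochain_Z φ ha) ⟨?_, mapCochain_fil φ hyf⟩
  exact ⟨mapCochain φ y, ⟨mapCochain_degPred φ hy.1, mapCochain_fil φ hy.2⟩, D_mapCochain φ y⟩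

lemma mapCochain_cocycles {n : ℕ} {x : K.Cochain} (hx : x ∈ K.cocycles n) :
    mapCochain φ x ∈ K'.cocycles n :=
  ⟨mapCochain_deg φ hx.1, (D_mapCochain φ x).trans
    ((congrArg _ (hx.2 : K.D x = 0)).trans (map_zero _))⟩

lemma mapCochain_coboundaries {n : ℕ} {x : K.Cochain} (hx : x ∈ K.coboundaries n) :
    mapCochain φ x ∈ K'.coboundaries n := by
  obtain ⟨y, hy, rfl⟩ := hx
  exact ⟨mapCochain φ y, mapCochain_degPred φ hy, D_mapCochain φ y⟩

/-- The map `Z_r^{p,q} → Z_r'^{p,q}` induced by a morphism of double complexes. -/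
def mapZ (r p n : ℕ) : K.Z r p n →+ K'.Z r p n :=
  ((mapCochain φ).comp (K.Z r p n).subtype).codRestrict _ fun x => mapCochain_Z φ x.2

/-- The map `E_r^{p,q} → E_r'^{p,q}` induced by a morphism of double complexes. -/
def mapE (r p n : ℕ) : K.E r p n →+ K'.E r p n :=
  QuotientAddGroup.map _ _ (mapZ φ r p n) fun _ hx => mapCochain_B φ hx

/-- The map on the cohomology of the total complexes induced by a morphism of double complexes. -/
def mapH (n : ℕ) : K.H n →+ K'.H n :=
  QuotientAddGroup.map _ _
    (((mapCochain φ).comp (K.cocycles n).subtype).codRestrict _ fun x => mapCochain_cocycles φ x.2)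
    fun _ hx => mapCochain_coboundaries φ hx

lemma mapH_edgeBot (p : ℕ) (e : K.E 2 p p) :
    mapH φ p (K.edgeBot p e) = K'.edgeBot p (mapE φ 2 p p e) := by
  obtain ⟨x, rfl⟩ := QuotientAddGroup.mk_surjective e
  rfl

lemma mapE_edgeLeft (n : ℕ) (c : K.H n) :
    mapE φ 2 0 n (K.edgeLeft n c) = K'.edgeLeft n (mapH φ n c) := by
  obtain ⟨x, rfl⟩ := QuotientAddGroup.mk_surjective c
  rfl

lemma mapE_dr (r p n : ℕ) (hr : 1 ≤ r) (e : K.E r p n) :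
    mapE φ r (p + r) (n + 1) (K.dr r p n hr e) = K'.dr r p n hr (mapE φ r p n e) := by
  obtain ⟨x, rfl⟩ := QuotientAddGroup.mk_surjective e
  exact congrArg QuotientAddGroup.mk (Subtype.ext (D_mapCochain φ x.1).symm)

end Map

/-! ### Double complexes with exact rows -/

section Rows

variable (K : DblCpx.{u})

lemma D_succ_zero (x : K.Cochain) (p : ℕ) :
    K.D x (p + 1) 0 = (-1 : ℤ) ^ p • K.d₁ p 0 (x p 0) :=
  add_zero _

lemma D_succ_succ (x : K.Cochain) (p q : ℕ) :
    K.D x (p + 1) (q + 1) =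
      (-1 : ℤ) ^ (p + (q + 1)) • K.d₁ p (q + 1) (x p (q + 1)) + K.d₂ (p + 1) q (x (p + 1) q) :=
  rfl

/-- The component in bidegree `(p + 1, q)` of `D x`, if `x^{p+1,q-1} = 0`. -/
lemma D_succ_of_vert_eq_zero (x : K.Cochain) (p q : ℕ) (hx : ∀ q', q' + 1 = q → x (p + 1) q' = 0) :
    K.D x (p + 1) q = (-1 : ℤ) ^ (p + q) • K.d₁ p q (x p q) := by
  rcases q with _ | q
  · exact D_succ_zero K x p
  · rw [D_succ_succ, hx q rfl, map_zero, add_zero]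

lemma neg_one_pow_smul_eq_zero {A : Type*} [AddCommGroup A] (n : ℕ) {a : A}
    (h : (-1 : ℤ) ^ n • a = 0) : a = 0 := by
  rcases neg_one_pow_eq_or ℤ n with hn | hn <;> rw [hn] at h <;> simpa using h

lemma neg_one_pow_smul_smul {A : Type*} [AddCommGroup A] (n : ℕ) (a : A) :
    (-1 : ℤ) ^ n • (-1 : ℤ) ^ n • a = a := by
  rw [smul_smul, ← mul_pow]
  simp

/-- The family with the single component `a` in bidegree `(p, q)`. -/
def single (p q : ℕ) (a : K.A p q) : K.Cochain := Pi.single p (Pi.single q a)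

lemma single_self (p q : ℕ) (a : K.A p q) : K.single p q a p q = a := by
  simp [single]

lemma single_eq_zero (p q : ℕ) (a : K.A p q) (i j : ℕ) (h : i ≠ p ∨ j ≠ q) :
    K.single p q a i j = 0 := by
  by_cases hi : i = p
  · subst hi
    have hj : j ≠ q := by simpa using h
    simp [single, hj]
  · simp [single, hi]

/-- If the rows are exact in the columns `p ≥ 1`, then a family of degree `n` whose total
differential lives in the column `p = 0` is, up to coboundaries, itself in the column `p = 0`:
its components in the columns `p ≥ 1` are removed one by one, starting from the largest `p`. -/
lemma exists_sub_D_column_zero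
    (hK : ∀ p q (a : K.A (p + 1) q), K.d₁ (p + 1) q a = 0 → ∃ b, K.d₁ p q b = a)
    (n : ℕ) (x : K.Cochain) (hx : x ∈ K.deg n) (hD : ∀ p q, K.D x (p + 1) q = 0) :
    ∃ z ∈ K.degPred n, ∀ p q, (x - K.D z) (p + 1) q = 0 := by
  suffices h : ∀ (k : ℕ) (x : K.Cochain), x ∈ K.deg n → (∀ p q, K.D x (p + 1) q = 0) →
      (∀ p q, k < p → x p q = 0) →
      ∃ z ∈ K.degPred n, ∀ p q, (x - K.D z) (p + 1) q = 0 from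
    h n x hx hD fun p q hp => hx p q (by omega)
  clear hD hx x
  intro k
  induction k with
  | zero => exact fun x _ _ h0 => ⟨0, zero_mem _, fun p q => by simp [h0 (p + 1) q (by omega)]⟩
  | succ k ih =>
    intro x hx hD hk
    by_cases hkn : n < k + 1
    · refine ih x hx hD fun p q hp => ?_
      by_cases h : k + 1 < p
      · exact hk p q h
      · exact hx p q (by omega)
    obtain ⟨q, rfl⟩ : ∃ q, n = k + 1 + q := ⟨n - (k + 1), by omega⟩
    have hd : K.d₁ (k + 1) q (x (k + 1) q) = 0 := by
      have h := hD (k + 1) q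
      rw [D_succ_of_vert_eq_zero K x (k + 1) q fun q' _ => hk _ _ (by omega)] at h
      exact neg_one_pow_smul_eq_zero _ h
    obtain ⟨b, hb⟩ := hK k q _ hd
    let w : K.Cochain := K.single k q ((-1 : ℤ) ^ (k + q) • b)
    have hw : w ∈ K.degPred (k + 1 + q) := fun i j h =>
      single_eq_zero K _ _ _ _ _ (by by_contra h'; push Not at h'; omega)
    have hxw : x - K.D w ∈ K.deg (k + 1 + q) := sub_mem hx (D_degPred K _ _ hw)
    obtain ⟨z, hz, h⟩ := ih (x - K.D w) hxw
      (fun i j => by rw [map_sub, D_D, sub_zero]; exact hD i j) (fun i j hi => by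
        by_cases hij : i + j = k + 1 + q
        · have hwi : ∀ j', w i j' = 0 := fun j' => single_eq_zero K _ _ _ _ _ (Or.inl (by omega))
          obtain ⟨i, rfl⟩ : ∃ i', i = i' + 1 := ⟨i - 1, by omega⟩
          change x (i + 1) j - K.D w (i + 1) j = 0
          rw [D_succ_of_vert_eq_zero K w i j fun q' _ => hwi q']
          by_cases hik : i = k
          · subst hik
            obtain rfl : j = q := by omega
            have hwq : w i j = (-1 : ℤ) ^ (i + j) • b := single_self K _ _ _
            rw [hwq, map_zsmul, neg_one_pow_smul_smul, hb, sub_self]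
          · have hwq : w i j = 0 := single_eq_zero K _ _ _ _ _ (Or.inl hik)
            rw [hwq, map_zero, smul_zero, hk _ _ (by omega), sub_zero]
        · exact hxw i j hij)
    refine ⟨w + z, add_mem hw hz, fun i j => ?_⟩
    rw [map_add, ← sub_sub]
    exact h i j

end Rows

end DblCpx

/-! ### The second terms of the spectral sequence -/

section ClassHom

variable (C : CochainComplex AddCommGrpCat.{u} ℕ) (n : ℕ)

lemma toCyc_surjective : Function.Surjective (toCyc C n) := by
  intro z
  have hz : C.d n (n + 1) (C.iCycles n z) = 0 :=
    DFunLike.congr_fun (congrArg AddCommGrpCat.Hom.hom (C.iCycles_d n (n + 1))) z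
  exact ⟨⟨C.iCycles n z, hz⟩, (AddCommGrpCat.mono_iff_injective (C.iCycles n)).1 inferInstance
    (iCycles_toCyc C n _)⟩

lemma classHom_surjective : Function.Surjective (classHom C n) :=
  ((AddCommGrpCat.epi_iff_surjective (C.homologyπ n)).1 inferInstance).comp (toCyc_surjective C n)

lemma exists_boundary_of_classHom_eq_zero (m : ℕ) (hm : (ComplexShape.up ℕ).prev n = m)
    (x : (C.d n (n + 1)).hom.ker) (hx : classHom C n x = 0) : ∃ y, C.d m n y = x.1 := by
  have hS : (ShortComplex.mk (C.toCycles m n) (C.homologyπ n) (by simp)).Exact :=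
    ShortComplex.exact_of_g_is_cokernel _ (C.homologyIsCokernel m n hm)
  obtain ⟨y, hy⟩ := (ShortComplex.ab_exact_iff _).1 hS (toCyc C n x) hx
  refine ⟨y, ?_⟩
  rw [← iCycles_toCyc C n x, ← hy]
  exact (DFunLike.congr_fun (congrArg AddCommGrpCat.Hom.hom (C.toCycles_i m n)) y).symm

lemma homologyMap_classHom {C C' : CochainComplex AddCommGrpCat.{u} ℕ} (g : C ⟶ C') (n : ℕ)
    (x : (C.d n (n + 1)).hom.ker) (x' : (C'.d n (n + 1)).hom.ker) (h : g.f n x.1 = x'.1) :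
    HomologicalComplex.homologyMap g n (classHom C n x) = classHom C' n x' := by
  have hc : HomologicalComplex.cyclesMap g n (toCyc C n x) = toCyc C' n x' := by
    apply (AddCommGrpCat.mono_iff_injective (C'.iCycles n)).1 inferInstance
    rw [iCycles_toCyc, ← h, ← iCycles_toCyc C n x]
    exact DFunLike.congr_fun (congrArg AddCommGrpCat.Hom.hom
      (HomologicalComplex.cyclesMap_i g n)) (toCyc C n x)
  change _ = C'.homologyπ n (toCyc C' n x')
  rw [← hc]
  exact DFunLike.congr_fun (congrArg AddCommGrpCat.Hom.hom
    (HomologicalComplex.homologyπ_naturality g n)) (toCyc C n x)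

end ClassHom

section Ident

variable {N : TopCat.{u}} (L : CochainComplex (AbSheaf N) ℕ)

lemma vertClass_surjective (p q : ℕ) : Function.Surjective (vertClass L p q) := by
  intro s
  obtain ⟨t, ht⟩ := (AddCommGrpCat.epi_iff_surjective ((secF N p).map (L.homologyπ q))).1
    inferInstance s
  have h0 : (secF N p).map (L.d q (q + 1)) ((secF N p).map (L.iCycles q) t) = 0 := by
    rw [secF_comp, L.iCycles_d, Functor.map_zero]
    rfl
  have hker : (secF N p).map (L.iCycles q) t ∈ ((canDbl L).d₂ p q).ker := h0
  refine ⟨⟨_, hker⟩, ?_⟩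
  change (secF N p).map (L.homologyπ q) (cycLift L p q ⟨_, hker⟩) = s
  rw [cycLift_unique L p q ⟨_, hker⟩ t rfl, ht]

lemma exists_of_vertClass_eq_zero (p q q' : ℕ) (hq : (ComplexShape.up ℕ).prev q = q')
    (x : ((canDbl L).d₂ p q).ker) (hx : vertClass L p q x = 0) :
    ∃ y : (secF N p).obj (L.X q'), (secF N p).map (L.d q' q) y = x.1 := by
  have hS : (ShortComplex.mk (L.toCycles q' q) (L.homologyπ q) (by simp)).Exact :=
    ShortComplex.exact_of_g_is_cokernel _ (L.homologyIsCokernel q' q hq)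
  obtain ⟨y, hy⟩ : ∃ y : (secF N p).obj (L.X q'),
      (secF N p).map (L.toCycles q' q) y = cycLift L p q x :=
    (ShortComplex.ab_exact_iff _).1 (hS.map (secF N p)) (cycLift L p q x) hx
  refine ⟨y, ?_⟩
  rw [← cycLift_spec L p q x, ← hy, secF_comp, L.toCycles_i]

/-- An element of `A^{p,q}` with zero class in `Γ(N, 𝒜^p(H^q(L)))` is the vertical differential of a
family which lives in bidegree `(p, q - 1)`. -/
lemma exists_vert_of_vertClass_eq_zero (p q : ℕ) (x : ((canDbl L).d₂ p q).ker)
    (hx : vertClass L p q x = 0) :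
    ∃ w : (canDbl L).Cochain, (∀ i j, i ≠ p ∨ j + 1 ≠ q → w i j = 0) ∧
      (canDbl L).vert w p q = x.1 := by
  rcases q with _ | q
  · obtain ⟨y, hy⟩ := exists_of_vertClass_eq_zero L p 0 0 (by simp) x hx
    refine ⟨0, fun _ _ _ => rfl, ?_⟩
    rw [← hy, L.shape 0 0 (by simp), Functor.map_zero]
    rfl
  · obtain ⟨y, hy⟩ := exists_of_vertClass_eq_zero L p (q + 1) q (by simp) x hx
    refine ⟨(canDbl L).single p q y, fun i j h => DblCpx.single_eq_zero _ _ _ _ _ _ (by omega), ?_⟩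
    exact (congrArg ((canDbl L).d₂ p q) (DblCpx.single_self _ p q y)).trans hy

lemma identZ_surjective (p q : ℕ) : Function.Surjective (identZ L p q) := by
  intro c
  obtain ⟨s, rfl⟩ := classHom_surjective ((canSec N).obj (L.homology q)) p c
  obtain ⟨x, hx⟩ := vertClass_surjective L p q s.1
  have h1 : vertClass L (p + 1) q ⟨(canDbl L).d₁ p q x.1, d₁_mem_ker L p q x⟩ = 0 := by
    rw [← vertClass_d₁, hx]
    exact s.2
  obtain ⟨w, hw, hwx⟩ := exists_vert_of_vertClass_eq_zero L (p + 1) q _ h1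
  -- the vertical differential of the second summand cancels the horizontal one of the first
  let y : (canDbl L).Cochain := (canDbl L).single p q x.1 - (-1 : ℤ) ^ (p + q) • w
  have hw' : ∀ i j, i ≠ p + 1 ∨ j + 1 ≠ q → y i j = (canDbl L).single p q x.1 i j := by
    intro i j h
    change _ - (-1 : ℤ) ^ (p + q) • w i j = _
    rw [hw i j h, smul_zero, sub_zero]
  have hy0 : ∀ i j, (i ≠ p ∨ j ≠ q) → (i ≠ p + 1 ∨ j + 1 ≠ q) → y i j = 0 := fun i j h h' =>
    (hw' i j h').trans (DblCpx.single_eq_zero _ _ _ _ _ _ h)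
  have hypq : y p q = x.1 := (hw' p q (by omega)).trans (DblCpx.single_self _ _ _ _)
  have hy : y ∈ (canDbl L).Z 2 p (p + q) := by
    have hdeg : y ∈ (canDbl L).deg (p + q) := fun i j h => hy0 i j (by omega) (by omega)
    refine ⟨⟨hdeg, fun i j h => hy0 i j (by omega) (by omega)⟩, ?_⟩
    intro i j hi
    by_cases hij : i + j = p + q + 1
    swap
    · exact DblCpx.D_deg _ _ _ hdeg i j hij
    change (canDbl L).horiz y i j + (canDbl L).vert y i j = 0
    have hcases : i < p ∨ i = p ∨ i = p + 1 := by omega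
    rcases hcases with hi | rfl | rfl
    · have ha : (canDbl L).horiz y i j = 0 := by
        rcases i with _ | i
        · rfl
        · change _ • (canDbl L).d₁ i j (y i j) = 0
          rw [hy0 i j (by omega) (by omega), map_zero, smul_zero]
      have hb : (canDbl L).vert y i j = 0 := by
        rcases j with _ | j
        · rfl
        · change (canDbl L).d₂ i j (y i j) = 0
          rw [hy0 i j (by omega) (by omega), map_zero]
      rw [ha, hb, add_zero]
    · obtain rfl : j = q + 1 := by omega
      have ha : (canDbl L).horiz y i (q + 1) = 0 := by
        rcases i with _ | i
        · rfl
        · change _ • (canDbl L).d₁ i (q + 1) (y i (q + 1)) = 0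
          rw [hy0 i (q + 1) (by omega) (by omega), map_zero, smul_zero]
      have hb : (canDbl L).vert y i (q + 1) = 0 := by
        change (canDbl L).d₂ i q (y i q) = 0
        rw [hypq]
        exact x.2
      rw [ha, hb, add_zero]
    · obtain rfl : j = q := by omega
      have hb : (canDbl L).vert y (p + 1) j = -((-1 : ℤ) ^ (p + j) • (canDbl L).vert w (p + 1) j) := by
        rcases j with _ | j
        · exact (by simp : (0 : (canDbl L).A (p + 1) 0) = -((-1 : ℤ) ^ (p + 0) • 0))
        · change (canDbl L).d₂ (p + 1) j (((canDbl L).single p (j + 1) x.1) (p + 1) j -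
            (-1 : ℤ) ^ (p + (j + 1)) • w (p + 1) j) = -(_ • (canDbl L).d₂ (p + 1) j (w (p + 1) j))
          rw [DblCpx.single_eq_zero _ _ _ _ _ _ (by omega), zero_sub, map_neg, map_zsmul]
      rw [hb, hwx]
      change (-1 : ℤ) ^ (p + j) • (canDbl L).d₁ p j (y p j) + _ = 0
      rw [hypq]
      exact add_neg_cancel _
  refine ⟨⟨y, hy⟩, ?_⟩
  have hl : lead L p q ⟨y, hy⟩ = x := Subtype.ext hypq
  refine congrArg (classHom ((canSec N).obj (L.homology q)) p) (Subtype.ext ?_)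
  change vertClass L p q (lead L p q ⟨y, hy⟩) = s.1
  rw [hl, hx]

/-- The elements of the kernel of `identZ` have the form `D y + z` with `y ∈ A^{p+q-1}` of filtration
`p - 1` and `z` of filtration `p + 1`. -/
lemma exists_D_eq_lead (p q : ℕ) (x : (canDbl L).Z 2 p (p + q)) (hx : identZ L p q x = 0) :
    ∃ y ∈ (canDbl L).degPred (p + q), y ∈ (canDbl L).fil (p + 1 - 2) ∧
      (canDbl L).D y ∈ (canDbl L).fil p ∧ (canDbl L).D y p q = x.1 p q := by
  obtain ⟨b, hb⟩ := exists_boundary_of_classHom_eq_zero _ p _ rfl _ hx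
  rcases p with _ | p
  · have h0 : vertClass L 0 q (lead L 0 q x) = 0 := by
      refine hb.symm.trans ?_
      rw [HomologicalComplex.shape _ _ _ (by simp)]
      rfl
    obtain ⟨w, hw, hwx⟩ := exists_vert_of_vertClass_eq_zero L 0 q _ h0
    refine ⟨w, fun i j h => hw i j (by omega), fun i j h => absurd h (by omega),
      fun i j h => absurd h (by omega), ?_⟩
    exact (zero_add _).trans hwx
  · revert b
    rw [show (ComplexShape.up ℕ).prev (p + 1) = p by simp]
    intro b hb
    obtain ⟨a, ha⟩ := vertClass_surjective L p q b
    let r : ((canDbl L).d₂ (p + 1) q).ker :=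
      lead L (p + 1) q x - ⟨(canDbl L).d₁ p q a.1, d₁_mem_ker L p q a⟩
    have h0 : vertClass L (p + 1) q r = 0 := by
      rw [map_sub, ← vertClass_d₁, ha, sub_eq_zero]
      exact hb.symm
    obtain ⟨w, hw, hwx⟩ := exists_vert_of_vertClass_eq_zero L (p + 1) q _ h0
    let v : (canDbl L).Cochain := (canDbl L).single p q ((-1 : ℤ) ^ (p + q) • a.1)
    have hv : ∀ i j, i ≠ p ∨ j ≠ q → v i j = 0 := DblCpx.single_eq_zero _ _ _ _
    have hvpq : v p q = (-1 : ℤ) ^ (p + q) • a.1 := DblCpx.single_self _ _ _ _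
    have hdeg : v + w ∈ (canDbl L).degPred (p + 1 + q) := by
      refine add_mem (fun i j h => hv i j (by omega)) (fun i j h => hw i j (by omega))
    have hDv : ∀ i, i ≤ p → ∀ j, (canDbl L).D v i j = 0 := by
      intro i hi j
      change (canDbl L).horiz v i j + (canDbl L).vert v i j = 0
      have ha : (canDbl L).horiz v i j = 0 := by
        rcases i with _ | i
        · rfl
        · change _ • (canDbl L).d₁ i j (v i j) = 0
          rw [hv i j (by omega), map_zero, smul_zero]
      have hb : (canDbl L).vert v i j = 0 := by
        rcases j with _ | j
        · rfl
        · change (canDbl L).d₂ i j (v i j) = 0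
          by_cases hij : i = p ∧ j = q
          · obtain ⟨rfl, rfl⟩ := hij
            rw [hvpq, map_zsmul, (a.2 : (canDbl L).d₂ i j a.1 = 0), smul_zero]
          · rw [hv i j (by omega), map_zero]
      rw [ha, hb, add_zero]
    refine ⟨v + w, hdeg, add_mem (fun i j h => hv i j (by omega)) (fun i j h => hw i j (by omega)),
      ?_, ?_⟩
    · rw [map_add]
      exact add_mem (fun i j h => hDv i (by omega) j)
        (DblCpx.D_fil _ _ _ fun i j h => hw i j (by omega))
    · rw [map_add]
      change (canDbl L).D v (p + 1) q + ((canDbl L).horiz w (p + 1) q +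
        (canDbl L).vert w (p + 1) q) = _
      rw [hwx, DblCpx.D_succ_of_vert_eq_zero _ v p q fun q' _ => hv _ _ (by omega), hvpq, map_zsmul,
        DblCpx.neg_one_pow_smul_smul]
      change _ + ((-1 : ℤ) ^ (p + q) • (canDbl L).d₁ p q (w p q) + (x.1 (p + 1) q - _)) = _
      rw [hw p q (by omega), map_zero, smul_zero, zero_add]
      exact add_sub_cancel _ _

theorem ident_bijective (p q : ℕ) : Function.Bijective (ident L p q) := by
  constructor
  · rw [injective_iff_map_eq_zero]
    intro e he
    obtain ⟨x, rfl⟩ := QuotientAddGroup.mk_surjective e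
    obtain ⟨y, hy, hyf, hDf, hDx⟩ := exists_D_eq_lead L p q x he
    refine (QuotientAddGroup.eq_zero_iff _).2 ?_
    change x.1 ∈ (canDbl L).B 2 p (p + q)
    rw [← sub_add_cancel x.1 ((canDbl L).D y)]
    have hdeg : x.1 - (canDbl L).D y ∈ (canDbl L).deg (p + q) :=
      sub_mem x.2.1.1 (DblCpx.D_degPred _ _ _ hy)
    refine AddSubgroup.add_mem_sup ⟨⟨hdeg, ?_⟩, ?_⟩ ⟨⟨y, ⟨hy, hyf⟩, rfl⟩, hDf⟩
    · intro i j hi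
      by_cases hij : i + j = p + q
      · by_cases hip : i = p
        · subst hip
          obtain rfl : j = q := by omega
          change x.1 i j - (canDbl L).D y i j = 0
          rw [hDx, sub_self]
        · change x.1 i j - (canDbl L).D y i j = 0
          rw [x.2.1.2 i j (by omega), hDf i j (by omega), sub_zero]
      · exact hdeg i j hij
    · change (canDbl L).D _ ∈ (canDbl L).fil (p + 1 + (2 - 1))
      rw [map_sub, DblCpx.D_D, sub_zero]
      exact x.2.2
  · intro c
    obtain ⟨x, rfl⟩ := identZ_surjective L p q c
    exact ⟨QuotientAddGroup.mk x, rfl⟩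

end Ident

/-! ### The limit of the spectral sequence -/

section Aug

variable {N : TopCat.{u}} (L : CochainComplex (AbSheaf N) ℕ)

lemma aug_classHom (n : ℕ) (x : ((globCpx L).d n (n + 1)).hom.ker)
    (y : (canDbl L).cocycles n) (hy : augCochain L n x.1 = y.1) :
    aug L n (classHom (globCpx L) n x) = QuotientAddGroup.mk y := by
  have h := Cofork.IsColimit.π_desc' ((globCpx L).homologyIsCokernel _ n rfl)
    (AddCommGrpCat.ofHom (augCyc L n)) ((augCyc_boundary L n).trans zero_comp.symm)
  have h' : aug L n (classHom (globCpx L) n x) = augCyc L n (toCyc (globCpx L) n x) :=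
    DFunLike.congr_fun (congrArg AddCommGrpCat.Hom.hom h) (toCyc (globCpx L) n x)
  rw [h']
  refine congrArg QuotientAddGroup.mk (Subtype.ext ?_)
  change augCochain L n ((globCpx L).iCycles n (toCyc (globCpx L) n x)) = y.1
  rw [iCycles_toCyc, hy]

/-- A family in the column `p = 0` whose total differential vanishes in the column `p = 1` comes
from a section of `L^n`, if the rows are exact at `p = 0`. -/
lemma exists_augCochain_eq
    (h0 : ∀ q (a : (canDbl L).A 0 q), (canDbl L).d₁ 0 q a = 0 → ∃ s, augSec L q s = a)
    (n : ℕ) (x : (canDbl L).Cochain) (hx : x ∈ (canDbl L).deg n)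
    (hcol : ∀ p q, x (p + 1) q = 0) (hD : (canDbl L).D x 1 n = 0) :
    ∃ s, augCochain L n s = x := by
  have hd : (canDbl L).d₁ 0 n (x 0 n) = 0 := by
    rw [DblCpx.D_succ_of_vert_eq_zero _ x 0 n fun q' _ => hcol 0 q'] at hD
    exact DblCpx.neg_one_pow_smul_eq_zero _ hD
  obtain ⟨s, hs⟩ := h0 n _ hd
  refine ⟨s, ?_⟩
  funext p q
  rcases p with _ | p
  · by_cases hq : q = n
    · subst hq
      rw [augCochain_self, hs]
    · rw [augCochain_ne _ _ _ _ hq, hx 0 q (by omega)]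
  · rw [augCochain_succ, hcol]

theorem aug_bijective (hinj : ∀ q, Function.Injective (augSec L q))
    (h0 : ∀ q (a : (canDbl L).A 0 q), (canDbl L).d₁ 0 q a = 0 → ∃ s, augSec L q s = a)
    (h1 : ∀ p q (a : (canDbl L).A (p + 1) q), (canDbl L).d₁ (p + 1) q a = 0 →
      ∃ b, (canDbl L).d₁ p q b = a) (n : ℕ) :
    Function.Bijective (aug L n) := by
  have hinj' : ∀ q, Function.Injective (augCochain L q) := fun q s t h => hinj q (by
    rw [← augCochain_self, ← augCochain_self, h])
  have hcyc : ∀ x : ((globCpx L).d n (n + 1)).hom.ker,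
      augCochain L n x.1 ∈ (canDbl L).cocycles n := fun x =>
    ⟨augCochain_deg L n _, (D_augCochain L n _).trans
      ((congrArg _ (x.2 : (globCpx L).d n (n + 1) x.1 = 0)).trans (map_zero _))⟩
  constructor
  · rw [injective_iff_map_eq_zero]
    intro c hc
    obtain ⟨x, rfl⟩ := classHom_surjective (globCpx L) n c
    rw [aug_classHom L n x ⟨_, hcyc x⟩ rfl] at hc
    obtain ⟨y, hy, hyx⟩ := (QuotientAddGroup.eq_zero_iff _).1 hc
    have hyx : (canDbl L).D y = augCochain L n x.1 := hyx
    rcases n with _ | n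
    · have hy0 : y = 0 := funext fun p => funext fun q => hy p q (by omega)
      rw [hy0, map_zero] at hyx
      have hx0 : x = 0 := Subtype.ext (hinj' 0 (hyx.symm.trans (map_zero (augCochain L 0)).symm))
      rw [hx0, map_zero]
    · have hyd : y ∈ (canDbl L).deg n := fun p q h => hy p q (by omega)
      obtain ⟨z, hz, hyz⟩ := DblCpx.exists_sub_D_column_zero (canDbl L) h1 n y hyd fun p q => by
        rw [hyx, augCochain_succ]
      obtain ⟨s, hs⟩ := exists_augCochain_eq L h0 n (y - (canDbl L).D z)
        (sub_mem hyd (DblCpx.D_degPred _ _ _ hz)) hyz (by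
          rw [map_sub, DblCpx.D_D, sub_zero, hyx, augCochain_succ])
      refine classHom_boundary (globCpx L) n (n + 1) x s (hinj' (n + 1) ?_)
      rw [← D_augCochain, hs, map_sub, DblCpx.D_D, sub_zero, hyx]
  · intro c
    obtain ⟨x, rfl⟩ := QuotientAddGroup.mk_surjective c
    have hDx : (canDbl L).D x.1 = 0 := x.2.2
    obtain ⟨z, hz, hxz⟩ := DblCpx.exists_sub_D_column_zero (canDbl L) h1 n x.1 x.2.1 fun p q => by
      rw [hDx]; rfl
    have hD : (canDbl L).D (x.1 - (canDbl L).D z) = 0 := by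
      rw [map_sub, DblCpx.D_D, sub_zero, hDx]
    obtain ⟨s, hs⟩ := exists_augCochain_eq L h0 n (x.1 - (canDbl L).D z)
      (sub_mem x.2.1 (DblCpx.D_degPred _ _ _ hz)) hxz (by rw [hD]; rfl)
    have hs0 : (globCpx L).d n (n + 1) s = 0 := hinj' (n + 1) (by
      rw [← D_augCochain, hs, hD, map_zero])
    refine ⟨classHom (globCpx L) n ⟨s, hs0⟩, ?_⟩
    rw [aug_classHom L n _ ⟨_, hcyc ⟨s, hs0⟩⟩ rfl]
    refine QuotientAddGroup.eq.2 ⟨z, hz, ?_⟩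
    change (canDbl L).D z = -augCochain L n s + x.1
    rw [hs]
    abel

end Aug

/-! ### Sheaves that are direct summands of their sheaf of discontinuous sections -/

section Split

variable {X : TopCat.{u}}

lemma isSplitMono_discUnit_of_retract {T T' : AbSheaf X} (i : T ⟶ T') (r : T' ⟶ T) (h : i ≫ r = 𝟙 T)
    [IsSplitMono (discUnit T')] : IsSplitMono (discUnit T) :=
  ⟨⟨⟨(disc X).map i ≫ retraction (discUnit T') ≫ r, by
    rw [← Category.assoc, ← discUnit_naturality, Category.assoc, IsSplitMono.id_assoc, h]⟩⟩⟩

/-- The retraction of `𝒜⁰(T) → 𝒜⁰(𝒜⁰(T))` which evaluates the germ at `x` of a discontinuous section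
at the point `x`. -/
def discMul (T : AbSheaf X) : (disc X).obj ((disc X).obj T) ⟶ (disc X).obj T :=
  ⟨{app := fun _ => AddCommGrpCat.ofHom
      { toFun := fun s x => discEval T x.1 (s x)
        map_zero' := funext fun x => map_zero (discEval T x.1).hom
        map_add' := fun s t => funext fun x => map_add (discEval T x.1).hom (s x) (t x) }
    naturality := fun _ _ _ => rfl }⟩

instance (T : AbSheaf X) : IsSplitMono (discUnit ((disc X).obj T)) :=
  ⟨⟨⟨discMul T, abSheaf_hom_ext fun U s => funext fun x => discEval_germ T x.1 U.unop x.2 s⟩⟩⟩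

/-- The section of `𝒜⁰(T) → ℬ¹(T)` complementary to a retraction of `T → 𝒜⁰(T)`. -/
def quotSection (T : AbSheaf X) [IsSplitMono (discUnit T)] : (quot X).obj T ⟶ (disc X).obj T :=
  cokernel.desc (discUnit T) (𝟙 _ - retraction (discUnit T) ≫ discUnit T) (by
    rw [Preadditive.comp_sub, IsSplitMono.id_assoc, Category.comp_id, sub_self])

lemma quotπ_quotSection (T : AbSheaf X) [IsSplitMono (discUnit T)] :
    quotπ T ≫ quotSection T = 𝟙 _ - retraction (discUnit T) ≫ discUnit T :=
  cokernel.π_desc _ _ _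

lemma quotSection_quotπ (T : AbSheaf X) [IsSplitMono (discUnit T)] :
    quotSection T ≫ quotπ T = 𝟙 _ := by
  rw [← cancel_epi (quotπ T), ← Category.assoc, quotπ_quotSection, Preadditive.sub_comp,
    Category.assoc, discUnit_quotπ, comp_zero, sub_zero, Category.id_comp, Category.comp_id]

instance (T : AbSheaf X) [IsSplitMono (discUnit T)] : IsSplitMono (discUnit ((quot X).obj T)) :=
  isSplitMono_discUnit_of_retract (quotSection T) (quotπ T) (quotSection_quotπ T)

instance isSplitMono_discUnit_syz (T : AbSheaf X) [h : IsSplitMono (discUnit T)] :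
    ∀ p, IsSplitMono (discUnit ((syz X p).obj T))
  | 0 => h
  | p + 1 => by
    have := isSplitMono_discUnit_syz T p
    exact inferInstanceAs (IsSplitMono (discUnit ((quot X).obj ((syz X p).obj T))))

lemma glob_comp_apply {A B C : AbSheaf X} (φ : A ⟶ B) (ψ : B ⟶ C) (a : (glob X).obj A) :
    (glob X).map ψ ((glob X).map φ a) = (glob X).map (φ ≫ ψ) a := by
  rw [Functor.map_comp]; rfl

lemma glob_discUnit_injective (T : AbSheaf X) [IsSplitMono (discUnit T)] :
    Function.Injective ((glob X).map (discUnit T)) :=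
  (AddCommGrpCat.mono_iff_injective _).1 inferInstance

lemma glob_quotπ_surjective (T : AbSheaf X) [IsSplitMono (discUnit T)] :
    Function.Surjective ((glob X).map (quotπ T)) := fun b =>
  ⟨(glob X).map (quotSection T) b, by
    rw [glob_comp_apply, quotSection_quotπ, CategoryTheory.Functor.map_id]; rfl⟩

lemma exists_of_glob_quotπ_eq_zero (T : AbSheaf X) [IsSplitMono (discUnit T)]
    (a : (glob X).obj ((disc X).obj T)) (ha : (glob X).map (quotπ T) a = 0) :
    ∃ s, (glob X).map (discUnit T) s = a := by
  refine ⟨(glob X).map (retraction (discUnit T)) a, ?_⟩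
  have h : (glob X).map (quotπ T ≫ quotSection T) a = 0 := by
    rw [← glob_comp_apply, ha, map_zero]
  rw [quotπ_quotSection, Functor.map_sub, CategoryTheory.Functor.map_id] at h
  rw [glob_comp_apply]
  exact (sub_eq_zero.1 h).symm

lemma glob_quotπ_eq_zero (T : AbSheaf X) [IsSplitMono (discUnit T)]
    (a : (glob X).obj ((disc X).obj T)) (ha : (glob X).map (discD T) a = 0) :
    (glob X).map (quotπ T) a = 0 := by
  rw [discD, ← glob_comp_apply] at ha
  exact glob_discUnit_injective _ (ha.trans (map_zero ((glob X).map (discUnit _)).hom).symm)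

lemma exists_of_glob_discD_eq_zero (T : AbSheaf X) [IsSplitMono (discUnit T)]
    (a : (glob X).obj ((disc X).obj ((quot X).obj T)))
    (ha : (glob X).map (discD ((quot X).obj T)) a = 0) :
    ∃ b, (glob X).map (discD T) b = a := by
  obtain ⟨s, rfl⟩ := exists_of_glob_quotπ_eq_zero _ a (glob_quotπ_eq_zero _ a ha)
  obtain ⟨b, rfl⟩ := glob_quotπ_surjective T s
  exact ⟨b, (glob_comp_apply _ _ b).symm⟩

lemma secD_apply (T : AbSheaf X) (p : ℕ) (a : (glob X).obj ((can X p).obj T)) :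
    secD X p T a = (glob X).map (discD ((syz X p).obj T)) a := by
  change (glob X).map ((canResObj T).d p (p + 1)) a = _
  have := canResObj_d T p
  rw [this]
  rfl

end Split

/-- If each `L^q` is a direct summand of `𝒜⁰(L^q)`, its canonical resolution remains exact on global
sections, so the total complex computes the cohomology of `Γ(N, L^•)`. -/
theorem aug_bijective_of_isSplitMono {N : TopCat.{u}} (L : CochainComplex (AbSheaf N) ℕ)
    [∀ q, IsSplitMono (discUnit (L.X q))] (n : ℕ) : Function.Bijective (aug L n) := by
  refine aug_bijective L (fun q => glob_discUnit_injective (L.X q)) (fun q a ha => ?_)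
    (fun p q a ha => ?_) n
  · exact exists_of_glob_quotπ_eq_zero (L.X q) a
      (glob_quotπ_eq_zero _ _ ((secD_apply (L.X q) 0 a).symm.trans ha))
  · obtain ⟨b, hb⟩ := exists_of_glob_discD_eq_zero ((syz N p).obj (L.X q)) a
      ((secD_apply (L.X q) (p + 1) a).symm.trans ha)
    exact ⟨b, (secD_apply (L.X q) p b).trans hb⟩

section Push

variable {M N : TopCat.{u}} (f : M ⟶ N)

/-- The evaluation at `x` on the stalk of `f_* 𝒜⁰(T)` at `f x`. -/
def pushDiscEval (T : AbSheaf M) (x : M) :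
    (stalkAt N (f x)).obj ((push f).obj ((disc M).obj T)) ⟶ (stalkAt M x).obj T :=
  TopCat.Presheaf.stalkPushforward AddCommGrpCat.{u} f ((disc M).obj T).obj x ≫ discEval T x

lemma pushDiscEval_germ (T : AbSheaf M) (x : M) (U : Opens N) (hx : f x ∈ U)
    (s : ((disc M).obj T).obj.obj (op ((Opens.map f).obj U))) :
    pushDiscEval f T x (germAt ((push f).obj ((disc M).obj T)) U (f x) hx s) = s ⟨x, hx⟩ := by
  have h := DFunLike.congr_fun (congrArg AddCommGrpCat.Hom.hom
    (TopCat.Presheaf.stalkPushforward_germ AddCommGrpCat.{u} f ((disc M).obj T).obj U x hx)) s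
  exact (congrArg (discEval T x) h).trans (discEval_germ T x ((Opens.map f).obj U) hx s)

/-- A retraction of `f_* 𝒜⁰(T) → 𝒜⁰(f_* 𝒜⁰(T))`: the value at `x` of the image of a family of germs
is the value at `x` of its germ at `f x`. -/
def pushDiscMul (T : AbSheaf M) :
    (disc N).obj ((push f).obj ((disc M).obj T)) ⟶ (push f).obj ((disc M).obj T) :=
  ⟨{app := fun U => AddCommGrpCat.ofHom
      { toFun := fun s (x : (Opens.map f).obj U.unop) => pushDiscEval f T x.1 (s ⟨f x.1, x.2⟩)
        map_zero' := funext fun x => map_zero (pushDiscEval f T x.1).hom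
        map_add' := fun _ _ => funext fun x => map_add (pushDiscEval f T x.1).hom _ _ }
    naturality := fun _ _ _ => rfl }⟩

instance (T : AbSheaf M) : IsSplitMono (discUnit ((push f).obj ((disc M).obj T))) :=
  ⟨⟨⟨pushDiscMul f T, abSheaf_hom_ext fun U s => funext fun x =>
    pushDiscEval_germ f T x.1 U.unop x.2 s⟩⟩⟩

instance (S : AbSheaf M) (q : ℕ) : IsSplitMono (discUnit ((directImageCpx f S).X q)) :=
  inferInstanceAs (IsSplitMono (discUnit ((push f).obj ((disc M).obj ((syz M q).obj S)))))

theorem isLeray (S : AbSheaf M) : IsLeray f S where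
  ident_bijective p q := LerayFive.ident_bijective (directImageCpx f S) p q
  aug_bijective n := aug_bijective_of_isSplitMono (directImageCpx f S) n

end Push

/-! ### The five-term exact sequence of a continuous map -/

lemma exact_of_addEquiv {A B C A' B' C' : Type*} [AddCommGroup A] [AddCommGroup B] [AddCommGroup C]
    [AddCommGroup A'] [AddCommGroup B'] [AddCommGroup C'] (a : A ≃+ A') (b : B ≃+ B') (c : C ≃+ C')
    {g : A → B} {k : B → C} {g' : A' → B'} {k' : B' → C'} (h : Function.Exact g k)
    (hg : ∀ x, g' (a x) = b (g x)) (hk : ∀ x, k' (b x) = c (k x)) : Function.Exact g' k' := by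
  intro y
  obtain ⟨y, rfl⟩ := b.surjective y
  rw [hk, map_eq_zero_iff c c.injective, h y]
  constructor
  · rintro ⟨x, rfl⟩
    exact ⟨a x, hg x⟩
  · rintro ⟨x, hx⟩
    obtain ⟨x, rfl⟩ := a.surjective x
    exact ⟨x, b.injective ((hg x).symm.trans hx)⟩

namespace IsLeray

variable {M N : TopCat.{u}} {f : M ⟶ N} {S : AbSheaf M} (h : IsLeray f S)

lemma map₁_ident (e : (lerayDbl f S).E 2 1 1) :
    h.map₁ (h.identEquiv 1 0 e) = (h.augEquiv 1).symm ((lerayDbl f S).edgeBot 1 e) :=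
  congrArg (fun e => (h.augEquiv 1).symm ((lerayDbl f S).edgeBot 1 e))
    ((h.identEquiv 1 0).symm_apply_apply e)

lemma map₂_aug (c : (lerayDbl f S).H 1) :
    h.map₂ ((h.augEquiv 1).symm c) = h.identEquiv 0 1 ((lerayDbl f S).edgeLeft 1 c) :=
  congrArg (fun c => h.identEquiv 0 1 ((lerayDbl f S).edgeLeft 1 c))
    ((h.augEquiv 1).apply_symm_apply c)

lemma map₃_ident (e : (lerayDbl f S).E 2 0 1) :
    h.map₃ (h.identEquiv 0 1 e) =
      h.identEquiv 2 0 ((lerayDbl f S).dr 2 0 1 one_le_two e) :=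
  congrArg (fun e => h.identEquiv 2 0 ((lerayDbl f S).dr 2 0 1 one_le_two e))
    ((h.identEquiv 0 1).symm_apply_apply e)

lemma map₄_ident (e : (lerayDbl f S).E 2 2 2) :
    h.map₄ (h.identEquiv 2 0 e) = (h.augEquiv 2).symm ((lerayDbl f S).edgeBot 2 e) :=
  congrArg (fun e => (h.augEquiv 2).symm ((lerayDbl f S).edgeBot 2 e))
    ((h.identEquiv 2 0).symm_apply_apply e)

theorem fiveTermExact : h.FiveTermExact where
  injective₁ := (h.augEquiv 1).symm.injective.comp
    ((lerayDbl f S).edgeBot_one_injective.comp (h.identEquiv 1 0).symm.injective)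
  exact₁₂ := exact_of_addEquiv (h.identEquiv 1 0) (h.augEquiv 1).symm (h.identEquiv 0 1)
    (lerayDbl f S).exact_edgeBot_edgeLeft h.map₁_ident h.map₂_aug
  exact₂₃ := exact_of_addEquiv (h.augEquiv 1).symm (h.identEquiv 0 1) (h.identEquiv 2 0)
    (lerayDbl f S).exact_edgeLeft_dr h.map₂_aug h.map₃_ident
  exact₃₄ := exact_of_addEquiv (h.identEquiv 0 1) (h.identEquiv 2 0) (h.augEquiv 2).symm
    (lerayDbl f S).exact_dr_edgeBot h.map₃_ident h.map₄_ident

end IsLeray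

/-! ### The restriction of direct images to an open subset -/

lemma isIso_of_bijective_sections {X : TopCat.{u}} {T T' : AbSheaf X} (φ : T ⟶ T')
    (h : ∀ U, Function.Bijective (φ.hom.app U)) : IsIso φ := by
  have : ∀ U, IsIso (φ.hom.app U) := fun U =>
    (ConcreteCategory.isIso_iff_bijective (φ.hom.app U)).2 (h U)
  have : IsIso φ.hom := NatIso.isIso_of_isIso_app _
  have : IsIso ((TopCat.Sheaf.forget AddCommGrpCat.{u} X).map φ) := this
  exact isIso_of_reflects_iso φ (TopCat.Sheaf.forget AddCommGrpCat.{u} X)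

section Restriction

variable {X' X : TopCat.{u}} {j : X' ⟶ X} (hj : IsOpenEmbedding j)

instance isIso_resDisc (T : AbSheaf X) : IsIso (resDisc hj T) := by
  refine isIso_of_bijective_sections _ fun V => ⟨fun s t hst => funext fun x => ?_, fun t => ?_⟩
  · obtain ⟨_, y, hy, rfl⟩ := x
    exact resStalk_inj hj T y (congrFun hst ⟨y, hy⟩)
  · -- a point of `j(V)` determines the point of `V` over it, as `j` is injective
    have key : ∀ x : hj.functor.obj V.unop, ∃ a : T.presheaf.stalk x.1,
        ∀ (y : X') (hy : y ∈ V.unop) (b : (stalkAt X (j y)).obj T), x.1 = j y → a ≍ b →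
          (resStalk hj T y).hom b = t ⟨y, hy⟩ := by
      rintro ⟨_, y, hy, rfl⟩
      obtain ⟨a, ha⟩ := resStalk_surj hj T y (t ⟨y, hy⟩)
      refine ⟨a, fun y' hy' b hx hab => ?_⟩
      obtain rfl : y = y' := hj.injective hx
      rw [← eq_of_heq hab]
      exact ha
    choose a ha using key
    exact ⟨a, funext fun y => ha ⟨j y.1, ⟨y.1, y.2, rfl⟩⟩ y.1 y.2 _ rfl HEq.rfl⟩

instance isIso_resQuot (T : AbSheaf X) : IsIso (resQuot hj T) :=
  (PreservesCokernel.iso (res hj) (discUnit T) ≪≫ cokernel.mapIso _ _ (Iso.refl _)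
    (asIso (resDisc hj T)) ((resDisc_unit hj T).trans (Category.id_comp _).symm)).isIso_hom

instance isIso_resSyz (T : AbSheaf X) : ∀ p, IsIso (resSyz hj T p)
  | 0 => inferInstanceAs (IsIso (𝟙 _))
  | p + 1 => by
    have := isIso_resSyz T p
    exact inferInstanceAs (IsIso (resQuot hj ((syz X p).obj T) ≫ (quot X').map (resSyz hj T p)))

instance isIso_resCan (T : AbSheaf X) (p : ℕ) : IsIso (resCan hj T p) :=
  inferInstanceAs (IsIso (resDisc hj ((syz X p).obj T) ≫ (disc X').map (resSyz hj T p)))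

instance isIso_resCanRes (T : AbSheaf X) : IsIso (resCanRes hj T) := by
  have : ∀ p, IsIso ((resCanRes hj T).f p) := fun p => isIso_resCan hj T p
  exact HomologicalComplex.Hom.isIso_of_components _

end Restriction

section Open

variable {M N : TopCat.{u}} (f : M ⟶ N) (N' : Opens N)

lemma preOpen_image_eq (V : Opens ((Opens.toTopCat N).obj N')) :
    (preOpen f N').isOpenEmbedding.functor.obj ((Opens.map (resMap f N')).obj V) =
      (Opens.map f).obj (N'.isOpenEmbedding.functor.obj V) := by
  refine le_antisymm (image_le _ _ (resMap_comm f N') V) ?_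
  rintro x ⟨y, hy, hyx⟩
  have hyx : y.1 = f x := hyx
  have hx : f x ∈ N' := hyx ▸ y.2
  refine ⟨⟨x, hx⟩, ?_, rfl⟩
  have : (⟨f x, hx⟩ : N') = y := Subtype.ext hyx.symm
  change (⟨f x, hx⟩ : N') ∈ V
  rw [this]
  exact hy

instance isIso_baseChange_app (F : AbSheaf M) :
    IsIso ((baseChange (preOpen f N').isOpenEmbedding N'.isOpenEmbedding
      (resMap_comm f N')).app F) := by
  refine isIso_of_bijective_sections _ fun V => ?_
  have : IsIso (homOfLE (image_le (preOpen f N').isOpenEmbedding N'.isOpenEmbedding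
      (resMap_comm f N') V.unop)) :=
    ⟨homOfLE (preOpen_image_eq f N' V.unop).ge, rfl, rfl⟩
  exact (ConcreteCategory.isIso_iff_bijective (F.obj.map (homOfLE (image_le
    (preOpen f N').isOpenEmbedding N'.isOpenEmbedding (resMap_comm f N') V.unop)).op)).1
      inferInstance

instance isIso_directImageCpxRes (S : AbSheaf M) :
    IsIso (directImageCpxRes (preOpen f N').isOpenEmbedding N'.isOpenEmbedding
      (resMap_comm f N') S) := by
  have : ∀ q, IsIso ((directImageCpxRes (preOpen f N').isOpenEmbedding N'.isOpenEmbedding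
      (resMap_comm f N') S).f q) := fun q =>
    inferInstanceAs (IsIso ((baseChange (preOpen f N').isOpenEmbedding N'.isOpenEmbedding
      (resMap_comm f N')).app ((can M q).obj S) ≫
        (push (resMap f N')).map (resCan (preOpen f N').isOpenEmbedding S q)))
  exact HomologicalComplex.Hom.isIso_of_components _

theorem isIso_directImageRestrict (S : AbSheaf M) (q : ℕ) :
    IsIso (directImageRestrict f S N' q) :=
  ((((directImageCpx f S).sc q).mapHomologyIso (restrict N')).symm ≪≫
    (HomologicalComplex.homologyFunctor _ _ q).mapIso (asIso (directImageCpxRes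
      (preOpen f N').isOpenEmbedding N'.isOpenEmbedding (resMap_comm f N') S))).isIso_hom

end Open

/-! ### Naturality of the identifications under restriction -/

section Naturality

variable {X' X : TopCat.{u}} {j : X' ⟶ X} (hj : IsOpenEmbedding j)

lemma resDisc_naturality {T T' : AbSheaf X} (φ : T ⟶ T') :
    (res hj).map ((disc X).map φ) ≫ resDisc hj T' =
      resDisc hj T ≫ (disc X').map ((res hj).map φ) :=
  abSheaf_hom_ext fun V s => funext fun y => resStalk_naturality hj φ y.1
    ((s : ∀ x : hj.functor.obj V.unop, T.presheaf.stalk x.1) ⟨j y.1, ⟨y.1, y.2, rfl⟩⟩)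

lemma resQuot_naturality {T T' : AbSheaf X} (φ : T ⟶ T') :
    (res hj).map ((quot X).map φ) ≫ resQuot hj T' =
      resQuot hj T ≫ (quot X').map ((res hj).map φ) := by
  rw [← cancel_epi ((res hj).map (quotπ T)), ← Category.assoc, ← Functor.map_comp,
    ← quotπ_naturality, Functor.map_comp, Category.assoc, resQuot_π, ← Category.assoc,
    resDisc_naturality, Category.assoc, quotπ_naturality, ← Category.assoc, ← resQuot_π,
    Category.assoc]

lemma resSyz_naturality {T T' : AbSheaf X} (φ : T ⟶ T') : ∀ p,
    (res hj).map ((syz X p).map φ) ≫ resSyz hj T' p =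
      resSyz hj T p ≫ (syz X' p).map ((res hj).map φ)
  | 0 => (Category.comp_id _).trans (Category.id_comp _).symm
  | p + 1 => by
    change (res hj).map ((quot X).map ((syz X p).map φ)) ≫ resQuot hj ((syz X p).obj T') ≫
      (quot X').map (resSyz hj T' p) = (resQuot hj ((syz X p).obj T) ≫
        (quot X').map (resSyz hj T p)) ≫ (quot X').map ((syz X' p).map ((res hj).map φ))
    rw [← Category.assoc, resQuot_naturality, Category.assoc, Category.assoc, ← Functor.map_comp,
      ← Functor.map_comp, resSyz_naturality φ p]

lemma resCan_naturality {T T' : AbSheaf X} (φ : T ⟶ T') (p : ℕ) :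
    (res hj).map ((can X p).map φ) ≫ resCan hj T' p =
      resCan hj T p ≫ (can X' p).map ((res hj).map φ) := by
  change (res hj).map ((disc X).map ((syz X p).map φ)) ≫ resDisc hj ((syz X p).obj T') ≫
    (disc X').map (resSyz hj T' p) = (resDisc hj ((syz X p).obj T) ≫
      (disc X').map (resSyz hj T p)) ≫ (disc X').map ((syz X' p).map ((res hj).map φ))
  rw [← Category.assoc, resDisc_naturality, Category.assoc, Category.assoc, ← Functor.map_comp,
    ← Functor.map_comp, resSyz_naturality]

/-- The restriction `Γ(X, 𝒜^•(T)) → Γ(X', 𝒜^•(T|_{X'}))`, as a natural transformation. -/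
def resSecNat : canSec X ⟶ res hj ⋙ canSec X' where
  app T := resSec hj T
  naturality T T' φ := by
    ext p s
    have h := DFunLike.congr_fun (congrArg AddCommGrpCat.Hom.hom
      (congrArg (glob X').map (resCan_naturality hj φ p)))
        ((resGlob hj).app ((can X p).obj T) s)
    refine Eq.trans ?_ h
    exact congrArg ((glob X').map (resCan hj T' p)) (DFunLike.congr_fun (congrArg
      AddCommGrpCat.Hom.hom ((resGlob hj).naturality ((can X p).map φ))) s)

/-- The restriction `Γ(X, 𝒜^p(T)) → Γ(X', 𝒜^p(T|_{X'}))`. -/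
def secRes (p : ℕ) (T : AbSheaf X) : (secF X p).obj T →+ (secF X' p).obj ((res hj).obj T) :=
  ((resSec hj T).f p).hom

lemma secRes_naturality {T T' : AbSheaf X} (φ : T ⟶ T') (p : ℕ) (s : (secF X p).obj T) :
    secRes hj p T' ((secF X p).map φ s) = (secF X' p).map ((res hj).map φ) (secRes hj p T s) :=
  DFunLike.congr_fun (congrArg AddCommGrpCat.Hom.hom
    (congrArg (fun ψ => HomologicalComplex.Hom.f ψ p) ((resSecNat hj).naturality φ))) s

end Naturality

lemma homologyπ_mapHomologyIso_hom {C D : Type*} [Category* C] [Category* D] [Abelian C] [Abelian D]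
    (F : C ⥤ D) [F.Additive] [F.PreservesHomology] (S : ShortComplex C) :
    (S.map F).homologyπ ≫ (S.mapHomologyIso F).hom =
      (S.mapCyclesIso F).hom ≫ F.map S.homologyπ := by
  rw [S.leftHomologyData.mapHomologyIso_eq F, S.leftHomologyData.mapCyclesIso_eq F]
  have h : F.map S.leftHomologyData.π ≫ F.map S.leftHomologyData.homologyIso.inv =
      F.map S.leftHomologyData.cyclesIso.inv ≫ F.map S.homologyπ := by
    rw [← F.map_comp, ← F.map_comp, ShortComplex.LeftHomologyData.π_comp_homologyIso_inv]
  have h' := (S.leftHomologyData.map F).homologyπ_comp_homologyIso_hom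
  exact (Category.assoc _ _ _).symm.trans ((congrArg (· ≫ _) h').trans ((Category.assoc _ _ _).trans
    ((congrArg (_ ≫ ·) h).trans (Category.assoc _ _ _).symm)))

section Restriction

variable {N' N : TopCat.{u}} {i : N' ⟶ N} (hi : IsOpenEmbedding i)
  {L : CochainComplex (AbSheaf N) ℕ} {L' : CochainComplex (AbSheaf N') ℕ}
  (φ : ((res hi).mapHomologicalComplex _).obj L ⟶ L')

variable (L) in
/-- The exact functor of restriction commutes with cycles. -/
def resCyclesIso (q : ℕ) :
    (((res hi).mapHomologicalComplex _).obj L).cycles q ≅ (res hi).obj (L.cycles q) :=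
  (L.sc q).mapCyclesIso (res hi)

variable (L) in
/-- The exact functor of restriction commutes with cohomology. -/
def resHomologyIso (q : ℕ) :
    (((res hi).mapHomologicalComplex _).obj L).homology q ≅ (res hi).obj (L.homology q) :=
  (L.sc q).mapHomologyIso (res hi)

variable (L) in
lemma resCyclesIso_hom_iCycles (q : ℕ) :
    (resCyclesIso hi L q).hom ≫ (res hi).map (L.iCycles q) =
      (((res hi).mapHomologicalComplex _).obj L).iCycles q :=
  (L.sc q).mapCyclesIso_hom_iCycles (res hi)

variable (L) in
lemma homologyπ_resHomologyIso_hom (q : ℕ) :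
    (((res hi).mapHomologicalComplex _).obj L).homologyπ q ≫ (resHomologyIso hi L q).hom =
      (resCyclesIso hi L q).hom ≫ (res hi).map (L.homologyπ q) :=
  homologyπ_mapHomologyIso_hom (res hi) (L.sc q)

/-- The component `L^q|_{N'} → L'^q` of a map of complexes `L|_{N'} → L'`. -/
def compRes (q : ℕ) : (res hi).obj (L.X q) ⟶ L'.X q := φ.f q

lemma compRes_comm (q q' : ℕ) :
    compRes hi φ q ≫ L'.d q q' = (res hi).map (L.d q q') ≫ compRes hi φ q' :=
  φ.comm q q'

/-- The map `H^q(L)|_{N'} → H^q(L')` induced by a map of complexes `L|_{N'} → L'`. -/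
def homologyRes (q : ℕ) : (res hi).obj (L.homology q) ⟶ L'.homology q :=
  (resHomologyIso hi L q).inv ≫ HomologicalComplex.homologyMap φ q

/-- The map on cycles induced by a map of complexes `L|_{N'} → L'`. -/
def cyclesRes (q : ℕ) : (res hi).obj (L.cycles q) ⟶ L'.cycles q :=
  (resCyclesIso hi L q).inv ≫ HomologicalComplex.cyclesMap φ q

lemma cyclesRes_iCycles (q : ℕ) :
    cyclesRes hi φ q ≫ L'.iCycles q = (res hi).map (L.iCycles q) ≫ compRes hi φ q := by
  rw [cyclesRes, Category.assoc, Iso.inv_comp_eq, HomologicalComplex.cyclesMap_i,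
    ← resCyclesIso_hom_iCycles]
  exact Category.assoc _ _ _

lemma map_homologyπ_homologyRes (q : ℕ) :
    (res hi).map (L.homologyπ q) ≫ homologyRes hi φ q = cyclesRes hi φ q ≫ L'.homologyπ q := by
  rw [homologyRes, cyclesRes, Category.assoc, Iso.eq_inv_comp, ← Category.assoc,
    ← homologyπ_resHomologyIso_hom, Category.assoc, Iso.hom_inv_id_assoc,
    HomologicalComplex.homologyπ_naturality]

/-- The map of double complexes `Γ(N, 𝒜^p(L^q)) → Γ(N', 𝒜^p(L'^q))` induced by a map of complexes
`L|_{N'} → L'`. -/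
def canDblRes : canDbl L ⟶ canDbl L' where
  f q := resSec hi (L.X q) ≫ (canSec N').map (compRes hi φ q)
  comm' q q' _ := by
    have h : resSec hi (L.X q) ≫ (canSec N').map ((res hi).map (L.d q q')) =
      (canSec N).map (L.d q q') ≫ resSec hi (L.X q') := ((resSecNat hi).naturality (L.d q q')).symm
    change (_ ≫ (canSec N').map (compRes hi φ q)) ≫ (canSec N').map (L'.d q q') =
      (canSec N).map (L.d q q') ≫ _ ≫ _
    rw [Category.assoc, ← Functor.map_comp, compRes_comm, ← Category.assoc, ← h, Functor.map_comp,
      Category.assoc]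

lemma vertClass_canDblRes (p q : ℕ) (x : ((canDbl L).d₂ p q).ker) (x' : ((canDbl L').d₂ p q).ker)
    (h : x'.1 = ((canDblRes hi φ).f q).f p x.1) :
    vertClass L' p q x' =
      (secF N' p).map (homologyRes hi φ q) (secRes hi p (L.homology q) (vertClass L p q x)) := by
  have hc : cycLift L' p q x' =
      (secF N' p).map (cyclesRes hi φ q) (secRes hi p (L.cycles q) (cycLift L p q x)) := by
    refine cycLift_unique _ _ _ _ _ ?_
    rw [secF_comp, cyclesRes_iCycles, ← secF_comp, ← secRes_naturality, cycLift_spec, h]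
    rfl
  change (secF N' p).map (L'.homologyπ q) (cycLift L' p q x') = (secF N' p).map _
    (secRes hi p (L.homology q) ((secF N p).map (L.homologyπ q) (cycLift L p q x)))
  rw [hc, secRes_naturality, secF_comp, secF_comp, map_homologyπ_homologyRes]

lemma ident_mapE (p q : ℕ) (e : (canDbl L).E 2 p (p + q)) :
    ident L' p q (DblCpx.mapE (canDblRes hi φ) 2 p (p + q) e) =
      (coh N' p).map (homologyRes hi φ q) (resCoh hi p (L.homology q) (ident L p q e)) := by
  obtain ⟨x, rfl⟩ := QuotientAddGroup.mk_surjective e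
  have h := homologyMap_classHom (resSec hi (L.homology q) ≫ (canSec N').map (homologyRes hi φ q)) p
    ⟨vertClass L p q (lead L p q x), lead_cocycle L p q x⟩
    ⟨vertClass L' p q (lead L' p q (DblCpx.mapZ (canDblRes hi φ) 2 p (p + q) x)),
      lead_cocycle L' p q _⟩
    (vertClass_canDblRes hi φ p q (lead L p q x)
      (lead L' p q (DblCpx.mapZ (canDblRes hi φ) 2 p (p + q) x)) rfl).symm
  rw [HomologicalComplex.homologyMap_comp] at h
  exact h.symm

/-- The map `Γ(N, L^•) → Γ(N', L'^•)` induced by a map of complexes `L|_{N'} → L'`. -/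
def globCpxRes : globCpx L ⟶ globCpx L' :=
  (NatTrans.mapHomologicalComplex (resGlob hi) _).app L ≫
    ((glob N').mapHomologicalComplex _).map φ

lemma canDblRes_augSec (n : ℕ) (s : (globCpx L).X n) :
    ((canDblRes hi φ).f n).f 0 (augSec L n s) = augSec L' n ((globCpxRes hi φ).f n s) := by
  have h : (res hi).map (discUnit (L.X n)) ≫ resCan hi (L.X n) 0 = discUnit _ := by
    change (res hi).map (discUnit (L.X n)) ≫ resDisc hi (L.X n) ≫ (disc N').map (𝟙 _) = _
    rw [CategoryTheory.Functor.map_id, Category.comp_id, resDisc_unit]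
  have h' := DFunLike.congr_fun (congrArg AddCommGrpCat.Hom.hom (congrArg (glob N').map
    ((congrArg (· ≫ (disc N').map (compRes hi φ n)) h).trans (discUnit_naturality (compRes hi φ n)).symm)))
      ((resGlob hi).app (L.X n) s)
  refine Eq.trans ?_ h'
  exact congrArg (fun t => (glob N').map ((disc N').map (compRes hi φ n))
    ((glob N').map (resCan hi (L.X n) 0) t)) (DFunLike.congr_fun (congrArg
      AddCommGrpCat.Hom.hom ((resGlob hi).naturality (discUnit (L.X n)))) s)

lemma mapCochain_augCochain (n : ℕ) (s : (globCpx L).X n) :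
    DblCpx.mapCochain (canDblRes hi φ) (augCochain L n s) =
      augCochain L' n ((globCpxRes hi φ).f n s) := by
  funext p q
  change ((canDblRes hi φ).f q).f p (augCochain L n s p q) = _
  rcases p with _ | p
  · by_cases hq : q = n
    · subst hq
      rw [augCochain_self, augCochain_self]
      exact canDblRes_augSec hi φ q s
    · rw [augCochain_ne _ _ _ _ hq, augCochain_ne _ _ _ _ hq]
      exact map_zero (((canDblRes hi φ).f q).f 0).hom
  · rw [augCochain_succ, augCochain_succ]
    exact map_zero (((canDblRes hi φ).f q).f (p + 1)).hom

lemma mapH_aug (n : ℕ) (c : (globCpx L).homology n) :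
    DblCpx.mapH (canDblRes hi φ) n (aug L n c) =
      aug L' n (HomologicalComplex.homologyMap (globCpxRes hi φ) n c) := by
  obtain ⟨x, rfl⟩ := classHom_surjective (globCpx L) n c
  have hx : (globCpx L').d n (n + 1) ((globCpxRes hi φ).f n x.1) = 0 := by
    have h := DFunLike.congr_fun (congrArg AddCommGrpCat.Hom.hom
      ((globCpxRes hi φ).comm n (n + 1))) x.1
    exact h.trans ((congrArg ((globCpxRes hi φ).f (n + 1)) x.2).trans
      (map_zero ((globCpxRes hi φ).f (n + 1)).hom))
  have hy : augCochain L n x.1 ∈ (canDbl L).cocycles n :=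
    ⟨augCochain_deg L n _, (D_augCochain L n _).trans
      ((congrArg _ (x.2 : (globCpx L).d n (n + 1) x.1 = 0)).trans (map_zero _))⟩
  rw [homologyMap_classHom (globCpxRes hi φ) n x ⟨_, hx⟩ rfl, aug_classHom L n x ⟨_, hy⟩ rfl,
    aug_classHom L' n ⟨_, hx⟩ ⟨_, DblCpx.mapCochain_cocycles (canDblRes hi φ) hy⟩
      (mapCochain_augCochain hi φ n x.1).symm]
  rfl

end Restriction

section Open

variable {M N : TopCat.{u}} (f : M ⟶ N) (S : AbSheaf M) (N' : Opens N)

/-- The restriction map from the double complex of `f` and `S` to the double complex of `f|_{M'}` and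
`S|_{M'}`. -/
def lerayDblRes : lerayDbl f S ⟶ lerayDbl (resMap f N') ((restrict (preOpen f N')).obj S) :=
  canDblRes N'.isOpenEmbedding (directImageCpxRes (preOpen f N').isOpenEmbedding
    N'.isOpenEmbedding (resMap_comm f N') S)

lemma lerayIdent_mapE (p q : ℕ) (e : (lerayDbl f S).E 2 p (p + q)) :
    lerayIdent (resMap f N') ((restrict (preOpen f N')).obj S) p q
      (DblCpx.mapE (lerayDblRes f S N') 2 p (p + q) e) = resE₂ f S N' p q (lerayIdent f S p q e) :=
  ident_mapE N'.isOpenEmbedding _ p q e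

lemma globCpxRes_directImageCpxRes :
    globCpxRes N'.isOpenEmbedding (directImageCpxRes (preOpen f N').isOpenEmbedding
      N'.isOpenEmbedding (resMap_comm f N') S) = resSec (preOpen f N').isOpenEmbedding S := by
  ext q s
  refine congrArg ((glob _).map (resCan (preOpen f N').isOpenEmbedding S q)) ?_
  exact (DFunLike.congr_fun (congrArg AddCommGrpCat.Hom.hom
    (((can M q).obj S).obj.map_comp _ _)) s).symm

lemma lerayAug_resH (n : ℕ) (c : (coh M n).obj S) :
    lerayAug (resMap f N') ((restrict (preOpen f N')).obj S) n (resH (preOpen f N') n S c) =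
      DblCpx.mapH (lerayDblRes f S N') n (lerayAug f S n c) := by
  refine Eq.trans ?_ (mapH_aug (L := directImageCpx f S) N'.isOpenEmbedding _ n c).symm
  rw [globCpxRes_directImageCpxRes]
  rfl

end Open

end LerayFive

end

theorem corollaryc {M N : TopCat.{u}} (f : M ⟶ N) (S : AbSheaf M) (N' : Opens N) :
    (∀ q, IsIso (directImageRestrict f S N' q)) ∧
    ∃ (h : IsLeray f S) (h' : IsLeray (resMap f N') ((restrict (preOpen f N')).obj S)),
      h.FiveTermExact ∧ h'.FiveTermExact ∧
      (∀ x, resH (preOpen f N') 1 S (h.map₁ x) = h'.map₁ (resE₂ f S N' 1 0 x)) ∧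
      (∀ x, resE₂ f S N' 0 1 (h.map₂ x) = h'.map₂ (resH (preOpen f N') 1 S x)) ∧
      (∀ x, resE₂ f S N' 2 0 (h.map₃ x) = h'.map₃ (resE₂ f S N' 0 1 x)) ∧
      (∀ x, resH (preOpen f N') 2 S (h.map₄ x) = h'.map₄ (resE₂ f S N' 2 0 x)) := by
  have h := isLeray f S
  have h' := isLeray (resMap f N') ((restrict (preOpen f N')).obj S)
  have hE : ∀ p q (e : (lerayDbl f S).E 2 p (p + q)), resE₂ f S N' p q (h.identEquiv p q e) =
      h'.identEquiv p q (DblCpx.mapE (lerayDblRes f S N') 2 p (p + q) e) := fun p q e =>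
    (lerayIdent_mapE f S N' p q e).symm
  have hH : ∀ n (c : (lerayDbl f S).H n), resH (preOpen f N') n S ((h.augEquiv n).symm c) =
      (h'.augEquiv n).symm (DblCpx.mapH (lerayDblRes f S N') n c) := fun n c => by
    obtain ⟨c, rfl⟩ := (h.augEquiv n).surjective c
    rw [AddEquiv.symm_apply_apply, AddEquiv.eq_symm_apply]
    exact lerayAug_resH f S N' n c
  refine ⟨isIso_directImageRestrict f N' S, h, h', h.fiveTermExact, h'.fiveTermExact,
    fun x => ?_, fun x => ?_, fun x => ?_, fun x => ?_⟩
  · obtain ⟨e, rfl⟩ := (h.identEquiv 1 0).surjective x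
    rw [hE, h.map₁_ident, h'.map₁_ident, hH, DblCpx.mapH_edgeBot]
  · obtain ⟨c, rfl⟩ := (h.augEquiv 1).symm.surjective x
    rw [hH, h.map₂_aug, h'.map₂_aug, hE, ← DblCpx.mapE_edgeLeft]
  · obtain ⟨e, rfl⟩ := (h.identEquiv 0 1).surjective x
    rw [hE, h.map₃_ident, h'.map₃_ident, hE]
    exact congrArg _ (DblCpx.mapE_dr (lerayDblRes f S N') 2 0 1 one_le_two e)
  · obtain ⟨e, rfl⟩ := (h.identEquiv 2 0).surjective x
    rw [hE, h.map₄_ident, h'.map₄_ident, hH, DblCpx.mapH_edgeBot]
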